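/- **Setting.** A $k$-clause on $n$ variables is a disjunction of $k$ literals on $k$ distinct variables. Let $n,m,c,k\in\mathbb N$ and $p\in[0,1]$ with $c\mid n$ and $2\le k\le c\le n/k$. In the community attachment model $F_k(n,m,c,p)$ one first chooses a uniformly random partition of the $n$ variables into $c$ communities of size $n/c$ each; given the partition, one generates $m$ clauses independently, each of which is, with probability $p$, a uniformly random $k$-clause all of whose variables lie in one community, and otherwise a uniformly random bridge clause, that is, a $k$-clause whose variables lie in $k$ different communities. A resolution refutation of a CNF formula $\varphi$ is a sequence of clauses containing the empty clause in which each clause is a clause of $\varphi$ or follows from two earlier ones by the rule $(v\lor W),(\lnot v\lor U)\vdash (W\lor U)$; its size is the number of clauses in the sequence. **Theorem.** Let $k\ge 3$ be an integer and $0<\varepsilon<1$ be fixed. Let $N\subseteq\mathbb N$, and let $x,t,z$ (real-valued), $m,c$ (with values in $\mathbb N$) and $p$ (with values in $[0,1]$) be functions of $n$ such that $k\le c\le n/k$, $c\mid n$ and $x>0$ for all $n\in N$. All limits are taken as $n\to\infty$ along $N$. Suppose that $t=\omega(1)$, $z=\omega(1)$, $c=o(n)$, that for all sufficiently large $n\in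 N$ $$t\le\min\Big\{\frac{xn}{2},\ \frac{x^{1-\frac{1}{y(k-1)}}\,n^{1-\frac1{k-1}}}{z}\Big\},\qquad y=\frac{2}{k+\varepsilon},$$ and that for all sufficiently large $n\in N$ $$m\le\frac{1}{2^{7k/2}(1+\varepsilon)c^{k-1}}\,x^{-(k-2-\varepsilon)/2}\,n .$$ Let $S=2^{\frac{\varepsilon}{4(k+\varepsilon)}xt}/8$. Then with high probability a formula $\varphi$ drawn from $F_k(n,m,c,p)$, if it is unsatisfiable, has no resolution refutation of size $\le S$; that is, $$\Pr_{\varphi\sim F_k(n,m,c,p)}\big[\varphi\text{ is satisfiable, or }\varphi\text{ has no resolution refutation of size}\le S\big]\longrightarrow 1 .$$ Moreover, if $\Pr[\varphi\text{ is unsatisfiable}]$ is bounded below by a positive constant for all sufficiently large $n\in N$, then also $$\Pr\big[\varphi\text{ has no resolution refutation of size}\le S\ \big|\ \varphi\text{ is unsatisfiable}\big]\longrightarrow 1 .$$ -/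

import Mathlib

open Filter Topology Asymptotics
open scoped ENNReal

/-! ### CNF formulas and resolution -/

/-- A literal over the variables `0, …, n - 1`: a variable with a sign (`true` is positive). -/
abbrev Literal (n : ℕ) : Type := Fin n × Bool

/-- A clause (disjunction) is the set of its literals. -/
abbrev Clause (n : ℕ) : Type := Finset (Literal n)

/-- A formula with `m` clauses on `n` variables: the conjunction of a list of `m` clauses. -/
abbrev Formula (n m : ℕ) : Type := Fin m → Clause n

/-- The set of variables occurring in a clause. -/
def Clause.vars {n : ℕ} (C : Clause n) : Finset (Fin n) := C.image Prod.fst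

/-- No assignment satisfies all clauses. -/
def Formula.Unsat {n m : ℕ} (φ : Formula n m) : Prop :=
  ∀ a : Fin n → Bool, ¬ ∀ i, ∃ l ∈ φ i, a l.1 = l.2

/-- The resolution rule: from `v ∨ W` and `¬ v ∨ U` infer `W ∨ U`. -/
def Resolves {n : ℕ} (C D E : Clause n) : Prop :=
  ∃ (v : Fin n) (W U : Clause n),
    C = insert (v, true) W ∧ D = insert (v, false) U ∧ E = W ∪ U

/-- `P` is a resolution refutation of `φ` of size `s`: a sequence of `s` clauses, each of which is
a clause of `φ` or is obtained from two earlier ones by the resolution rule, that contains the empty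
clause. -/
def IsRefutation {n m : ℕ} (φ : Formula n m) {s : ℕ} (P : Fin s → Clause n) : Prop :=
  (∀ i, (∃ j, P i = φ j) ∨ ∃ a < i, ∃ b < i, Resolves (P a) (P b) (P i)) ∧ ∃ i, P i = ∅

/-- `φ` has a resolution refutation of size at most the real number `S`. -/
def HasRefutationOfSizeLE {n m : ℕ} (φ : Formula n m) (S : ℝ) : Prop :=
  ∃ s : ℕ, (s : ℝ) ≤ S ∧ ∃ P : Fin s → Clause n, IsRefutation φ P

/-! ### The community attachment model -/

noncomputable section

/-- The uniform distribution on `s`. (For empty `s`, where there is none, a fixed point mass; this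
case does not occur for admissible parameters of the model below.) -/
def uniformOn {α : Type} [Nonempty α] (s : Finset α) : PMF α :=
  open Classical in
  if h : s.Nonempty then PMF.uniformOfFinset s h else PMF.pure (Classical.arbitrary α)

/-- A coin that shows `true` with probability `p`. -/
def coin (p : unitInterval) : PMF Bool :=
  PMF.ofFintype (fun b => ENNReal.ofReal (if b then (p : ℝ) else 1 - p)) (by
    rw [Fintype.sum_bool]
    simp only [if_true, Bool.false_eq_true, if_false]
    rw [← ENNReal.ofReal_add p.2.1 (by linarith [p.2.2])]
    simp)

/-- `m` independent draws from `q`. -/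
def iid {α : Type} [Fintype α] (m : ℕ) (q : PMF α) : PMF (Fin m → α) :=
  PMF.ofFintype (fun φ => ∏ i, q (φ i)) (by
    classical
    rw [← Fintype.piFinset_univ, ← Finset.prod_univ_sum]
    have h : ∑ a, q a = 1 := by rw [← tsum_fintype (L := .unconditional _)]; exact q.tsum_coe
    simp [h])

/-- The clauses of length `k` on `n` variables: `k` literals on `k` different variables. -/
def kClauses (n k : ℕ) : Finset (Clause n) :=
  {C | C.card = k ∧ C.vars.card = k}

/-- The partitions of the `n` variables into `c` communities, each of size `n / c`. -/
def communityPartitions (n c : ℕ) : Finset (Finpartition (Finset.univ : Finset (Fin n))) :=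
  {S | S.parts.card = c ∧ ∀ A ∈ S.parts, A.card = n / c}

/-- The clauses of length `k` within a community: all variables are in a single community. -/
def withinClauses {n : ℕ} (k : ℕ) (S : Finpartition (Finset.univ : Finset (Fin n))) :
    Finset (Clause n) :=
  {C ∈ kClauses n k | ∃ A ∈ S.parts, C.vars ⊆ A}

/-- The bridge clauses of length `k`: the variables are all in different communities. -/
def bridgeClauses {n : ℕ} (k : ℕ) (S : Finpartition (Finset.univ : Finset (Fin n))) :
    Finset (Clause n) :=
  {C ∈ kClauses n k | ∀ A ∈ S.parts, (C.vars ∩ A).card ≤ 1}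

/-- One random clause, given the communities: with probability `p` uniform among the clauses within
a community, otherwise uniform among the bridge clauses. -/
def clauseDist {n : ℕ} (k : ℕ) (p : unitInterval)
    (S : Finpartition (Finset.univ : Finset (Fin n))) : PMF (Clause n) :=
  (coin p).bind fun b => if b then uniformOn (withinClauses k S) else uniformOn (bridgeClauses k S)

/-- The community attachment model `F_k(n, m, c, p)`: choose a uniformly random partition into `c`
communities, then `m` independent random clauses. -/
def communityAttachment (k n m c : ℕ) (p : unitInterval) : PMF (Formula n m) :=
  (uniformOn (communityPartitions n c)).bind fun S => iid m (clauseDist k p S)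

/-- The parameters for which `F_k(n, m, c, p)` is defined: `c` divides `n` and
`2 ≤ k ≤ c ≤ n / k`. -/
def AdmissibleParams (k n c : ℕ) : Prop :=
  c ∣ n ∧ 2 ≤ k ∧ k ≤ c ∧ (c : ℝ) ≤ (n : ℝ) / k

/-- Probability of the event `E` under `q`. -/
def prob {α : Type} (q : PMF α) (E : Set α) : ℝ≥0∞ := q.toOuterMeasure E

/-- Conditional probability of the event `E` given the event `U` under `q`
(used only when `U` has positive probability). -/
def condProb {α : Type} (q : PMF α) (E U : Set α) : ℝ≥0∞ := prob q (E ∩ U) / prob q U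

/-- The bound `t ≤ min {x n / 2, x ^ (1 - 1 / (y (k - 1))) n ^ (1 - 1 / (k - 1)) / z}` on the size
of a restriction. -/
def RestrictionSizeBound (k n : ℕ) (x y z t : ℝ) : Prop :=
  t ≤ min (x * n / 2)
    (x ^ (1 - 1 / (y * ((k : ℝ) - 1))) * (n : ℝ) ^ (1 - 1 / ((k : ℝ) - 1)) / z)

/-! The model never uses the point mass in `uniformOn` when its parameters are admissible. -/

theorem AdmissibleParams.mul_le {k n c : ℕ} (h : AdmissibleParams k n c) : c * k ≤ n := by
  have hk : (0 : ℝ) < k := by exact_mod_cast (by have := h.2.1; omega : 0 < k)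
  have := (le_div_iff₀ hk).1 h.2.2.2
  exact_mod_cast this

theorem communityPartitions_nonempty {k n c : ℕ} (h : AdmissibleParams k n c) :
    (communityPartitions n c).Nonempty := by
  obtain ⟨d, rfl⟩ := h.1
  have hc : 0 < c := by have := h.2.1; have := h.2.2.1; omega
  have hm := h.mul_le
  have hd : d ≠ 0 := by
    rintro rfl
    have := h.2.1
    have : 0 < c * k := Nat.mul_pos hc (by omega)
    omega
  have e : c * d + 0 * (d + 1) = (Finset.univ : Finset (Fin (c * d))).card := by simp
  let Q := (⊥ : Finpartition (Finset.univ : Finset (Fin (c * d)))).equitabilise e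
  have hQ : ∀ A ∈ Q.parts, A.card = d := by
    intro A hA
    rcases Finpartition.card_eq_of_mem_parts_equitabilise hA with h | h
    · exact h
    · have h0 := Finpartition.card_filter_equitabilise_big
        (⊥ : Finpartition (Finset.univ : Finset (Fin (c * d)))) e
      rw [Finset.card_eq_zero] at h0
      have : A ∈ (∅ : Finset (Finset (Fin (c * d)))) := h0 ▸ Finset.mem_filter.2 ⟨hA, h⟩
      simp at this
  refine ⟨Q, ?_⟩
  simp only [communityPartitions, Finset.mem_filter, Finset.mem_univ, true_and]
  rw [Nat.mul_div_cancel_left d hc]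
  refine ⟨?_, hQ⟩
  have := Finpartition.card_parts_equitabilise
    (⊥ : Finpartition (Finset.univ : Finset (Fin (c * d)))) e hd
  simpa [Q] using this

theorem mem_kClauses_positive {n : ℕ} (T : Finset (Fin n)) :
    T.image (fun v => (v, true)) ∈ kClauses n T.card ∧
      Clause.vars (T.image (fun v => (v, true))) = T := by
  have hv : Clause.vars (T.image (fun v => (v, true))) = T := by
    simp [Clause.vars, Finset.image_image, Function.comp_def]
  refine ⟨?_, hv⟩
  simp only [kClauses, Finset.mem_filter, Finset.mem_univ, true_and, hv, and_true]
  exact Finset.card_image_of_injective _ fun a b hab => by simpa using hab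

theorem withinClauses_nonempty {k n c : ℕ} (h : AdmissibleParams k n c)
    {S : Finpartition (Finset.univ : Finset (Fin n))} (hS : S ∈ communityPartitions n c) :
    (withinClauses k S).Nonempty := by
  simp only [communityPartitions, Finset.mem_filter, Finset.mem_univ, true_and] at hS
  have hc : 0 < c := by have := h.2.1; have := h.2.2.1; omega
  obtain ⟨A, hA⟩ := Finset.card_pos.1 (hS.1 ▸ hc)
  have hk : k ≤ A.card := by
    rw [hS.2 A hA, Nat.le_div_iff_mul_le hc, mul_comm]
    exact h.mul_le
  obtain ⟨T, hTA, rfl⟩ := Finset.exists_subset_card_eq hk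
  obtain ⟨h1, h2⟩ := mem_kClauses_positive T
  exact ⟨_, Finset.mem_filter.2 ⟨h1, A, hA, h2.symm ▸ hTA⟩⟩

theorem bridgeClauses_nonempty {k n c : ℕ} (h : AdmissibleParams k n c)
    {S : Finpartition (Finset.univ : Finset (Fin n))} (hS : S ∈ communityPartitions n c) :
    (bridgeClauses k S).Nonempty := by
  simp only [communityPartitions, Finset.mem_filter, Finset.mem_univ, true_and] at hS
  have hk : k ≤ S.parts.card := hS.1 ▸ h.2.2.1
  obtain ⟨R, hRS, hR⟩ := Finset.exists_subset_card_eq hk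
  choose f hf using fun A : S.parts => S.nonempty_of_mem_parts A.2
  let g : R → Fin n := fun A => f ⟨A.1, hRS A.2⟩
  have hg : ∀ A : R, g A ∈ A.1 := fun A => hf ⟨A.1, hRS A.2⟩
  have hinj : Function.Injective g := by
    intro A B hAB
    exact Subtype.ext (S.eq_of_mem_parts (hRS A.2) (hRS B.2) (hg A) (hAB ▸ hg B))
  let T : Finset (Fin n) := Finset.univ.image g
  have hT : T.card = k := by
    rw [Finset.card_image_of_injective _ hinj]; simpa using hR
  obtain ⟨h1, h2⟩ := mem_kClauses_positive T
  rw [hT] at h1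
  refine ⟨_, Finset.mem_filter.2 ⟨h1, fun A hA => ?_⟩⟩
  rw [h2, Finset.card_le_one]
  intro a ha b hb
  obtain ⟨haT, haA⟩ := Finset.mem_inter.1 ha
  obtain ⟨hbT, hbA⟩ := Finset.mem_inter.1 hb
  obtain ⟨B, -, rfl⟩ := Finset.mem_image.1 haT
  obtain ⟨D, -, rfl⟩ := Finset.mem_image.1 hbT
  have e1 := S.eq_of_mem_parts (hRS B.2) hA (hg B) haA
  have e2 := S.eq_of_mem_parts (hRS D.2) hA (hg D) hbA
  have : B = D := Subtype.ext (e1.trans e2.symm)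
  rw [this]

end

/-!
The proof is a first-moment argument on expansion, combined with a random restriction.

Fix the communities. Every `k`-set of variables is the variable set of a random clause with
probability at most `K / n.choose k`, where `K = (1 + ε) c ^ (k - 1)`: there are about
`c * (n / c).choose k` sets within a community, and this is the worse case (`prob_clauseDist_le`).
Hence, with `K` as a loss per clause, one can argue as for uniformly random formulas.

Restrict the formula by fixing the variables in a set `T` of size at most `t`, and let
`r₀ = x n / (k + ε)`. With high probability (`prob_not_expands_le` and the estimates following it)
* every set of at most `r₀` clauses satisfies Hall's condition outside `T`, so that it remains
  satisfiable. A direct union bound is too weak for small sets of clauses. But the bound on `t`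
  excludes clauses with at most one variable outside `T`. If Hall's condition fails for `r` other
  clauses, then each of them has at least two variables in a common set of `r - 1` variables, and
  the resulting factor `((r - 1) / n) ^ 2` per clause suffices;
* every set of `r` clauses with `r₀ / 2 < r ≤ r₀` has more than `r (k + ε) / 2` variables outside
  `T`, so that more than `ε r` of these occur in only one clause of the set.

If both hold, then for every assignment to `T` each refutation contains a clause with at least
`ε r₀ / 2` literals that the assignment does not satisfy (`Formula.Expands.exists_wide`). This is the
width argument of Ben-Sasson and Wigderson, with semantic implication from clauses of the formula, so
that refutations need not be restricted. A random restriction with one literal in each of about `t`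
blocks of variables satisfies a clause of that width except with probability
`exp (-ε r₀ t / (4 n))` or so (`card_not_killed_le`). Hence a formula with a refutation of size
at most `S` fails to expand relative to at least half of the restrictions, which is unlikely by
Markov's inequality (`prob_half_le`).

For `x > 1` the formula has so few clauses that Hall's condition holds for all sets of clauses, and
the formula is satisfiable with high probability (`prob_unsat_le`).
-/

/-! ### Probabilities of events -/

theorem prob_bind_le {α β : Type} {q : PMF α} {f : α → PMF β} {E : Set β} {η : ℝ≥0∞}
    (h : ∀ a ∈ q.support, prob (f a) E ≤ η) : prob (q.bind f) E ≤ η := by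
  unfold prob at *
  rw [PMF.toOuterMeasure_bind_apply]
  calc ∑' a, q a * (f a).toOuterMeasure E ≤ ∑' a, q a * η := by
        refine ENNReal.tsum_le_tsum fun a => ?_
        by_cases ha : a ∈ q.support
        · gcongr; exact h a ha
        · simp [(PMF.apply_eq_zero_iff q a).2 ha]
    _ = η := by rw [ENNReal.tsum_mul_right, q.tsum_coe, one_mul]

theorem prob_uniformOn {α : Type} [Nonempty α] {s : Finset α} (hs : s.Nonempty) (E : Set α)
    [DecidablePred (· ∈ E)] :
    prob (uniformOn s) E = ((s.filter (· ∈ E)).card : ℝ≥0∞) / s.card := by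
  classical
  unfold prob uniformOn
  rw [dif_pos hs, PMF.toOuterMeasure_uniformOfFinset_apply]
  congr!

theorem mem_of_mem_support_uniformOn {α : Type} [Nonempty α] {s : Finset α} (hs : s.Nonempty)
    {a : α} (ha : a ∈ (uniformOn s).support) : a ∈ s := by
  unfold uniformOn at ha
  rw [dif_pos hs] at ha
  simpa using ha

theorem prob_eq_sum {α : Type} [Fintype α] (q : PMF α) (E : Set α) [DecidablePred (· ∈ E)] :
    prob q E = ∑ a, if a ∈ E then q a else 0 := by
  classical
  rw [prob, PMF.toOuterMeasure_apply, tsum_fintype (L := .unconditional _)]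
  simp [Set.indicator_apply]

theorem prob_mono {α : Type} (q : PMF α) {E F : Set α} (h : E ⊆ F) : prob q E ≤ prob q F :=
  MeasureTheory.measure_mono h

theorem prob_union_le {α : Type} (q : PMF α) (E F : Set α) :
    prob q (E ∪ F) ≤ prob q E + prob q F :=
  MeasureTheory.measure_union_le E F

theorem prob_le_one {α : Type} (q : PMF α) (E : Set α) : prob q E ≤ 1 := by
  classical
  rw [prob, PMF.toOuterMeasure_apply, ← q.tsum_coe]
  exact ENNReal.tsum_le_tsum fun a => Set.indicator_le_self _ _ a

theorem prob_add_prob_compl {α : Type} (q : PMF α) (E : Set α) : prob q E + prob q Eᶜ = 1 := by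
  classical
  rw [prob, prob, PMF.toOuterMeasure_apply, PMF.toOuterMeasure_apply, ← ENNReal.tsum_add,
    ← q.tsum_coe]
  exact tsum_congr fun a => by by_cases h : a ∈ E <;> simp [h]

theorem prob_inter_add_prob_diff {α : Type} (q : PMF α) (U E : Set α) :
    prob q (U ∩ E) + prob q (U \ E) = prob q U := by
  classical
  simp only [prob, PMF.toOuterMeasure_apply]
  rw [← ENNReal.tsum_add]
  exact tsum_congr fun a => by by_cases h : a ∈ E <;> by_cases h' : a ∈ U <;> simp [h, h']

theorem prob_iid_forall_mem {α : Type} [Fintype α] {m : ℕ} (q : PMF α) (R : Finset (Fin m))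
    (E : Set α) : prob (iid m q) {φ | ∀ i ∈ R, φ i ∈ E} = prob q E ^ R.card := by
  classical
  have key : ∀ φ : Fin m → α, (if φ ∈ {φ : Fin m → α | ∀ i ∈ R, φ i ∈ E} then iid m q φ else 0)
      = ∏ i, (if i ∈ R then (if φ i ∈ E then q (φ i) else 0) else q (φ i)) := by
    intro φ
    have hq : iid m q φ = ∏ i, q (φ i) := rfl
    split_ifs with h
    · rw [hq]
      refine Finset.prod_congr rfl fun i _ => ?_
      by_cases hi : i ∈ R
      · simp [hi, h i hi]
      · simp [hi]
    · simp only [Set.mem_ofPred_eq, not_forall] at h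
      obtain ⟨i, hi, hE⟩ := h
      exact (Finset.prod_eq_zero (Finset.mem_univ i) (by simp [hi, hE])).symm
  have h1 : ∑ a, q a = 1 := by
    rw [← tsum_fintype (L := .unconditional _)]; exact q.tsum_coe
  rw [prob_eq_sum, Finset.sum_congr rfl fun φ _ => key φ,
    ← Fintype.piFinset_univ, ← Finset.prod_univ_sum (fun _ => Finset.univ)
      (fun i a => if i ∈ R then (if a ∈ E then q a else 0) else q a)]
  have : ∀ i, (∑ a, if i ∈ R then (if a ∈ E then q a else 0) else q a)
      = if i ∈ R then prob q E else 1 := by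
    intro i
    split_ifs
    · rw [prob_eq_sum]
    · exact h1
  simp_rw [this]
  rw [Finset.prod_ite_mem, Finset.univ_inter, Finset.prod_const]

theorem prob_exists_mem_finset_le {α ι : Type} (q : PMF α) (J : Finset ι) (E : ι → Set α) :
    prob q {a | ∃ j ∈ J, a ∈ E j} ≤ ∑ j ∈ J, prob q (E j) := by
  have : {a | ∃ j ∈ J, a ∈ E j} = ⋃ j ∈ J, E j := by ext; simp
  rw [this]
  exact MeasureTheory.measure_biUnion_finset_le J E

/-- Union bound over the `r`-sets of indices and a family of events: the chance that some `r` of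
the `m` draws all fall into a common event of the family. -/
theorem prob_iid_exists_common_le {α ι : Type} [Fintype α] {m : ℕ} (q : PMF α) (r : ℕ)
    (J : Finset ι) (E : ι → Set α) {η : ℝ≥0∞} (h : ∀ A ∈ J, prob q (E A) ≤ η) :
    prob (iid m q) {φ | ∃ R : Finset (Fin m), R.card = r ∧ ∃ A ∈ J, ∀ i ∈ R, φ i ∈ E A}
      ≤ (m.choose r : ℝ≥0∞) * J.card * η ^ r := by
  calc _ ≤ prob (iid m q) {φ | ∃ RA ∈ (Finset.univ : Finset (Fin m)).powersetCard r ×ˢ J,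
            φ ∈ {φ : Fin m → α | ∀ i ∈ RA.1, φ i ∈ E RA.2}} := by
        refine prob_mono _ ?_
        rintro φ ⟨R, hR, A, hA, hφ⟩
        exact ⟨(R, A), by simp [hR, hA], hφ⟩
    _ ≤ ∑ RA ∈ (Finset.univ : Finset (Fin m)).powersetCard r ×ˢ J, η ^ r := by
        refine (prob_exists_mem_finset_le _ _ _).trans (Finset.sum_le_sum ?_)
        rintro ⟨R, A⟩ hRA
        simp only [Finset.mem_product, Finset.mem_powersetCard] at hRA
        rw [prob_iid_forall_mem, hRA.1.2]
        gcongr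
        exact h A hRA.2
    _ = _ := by simp [mul_assoc]

/-- Averaging over a finite family of bad events: if each has probability at most `η`, then it is
unlikely (Markov's inequality) that at least half of them occur. -/
theorem prob_half_le {α Ω : Type} [Fintype α] [Fintype Ω] [Nonempty Ω] (q : PMF α)
    (B : Ω → Set α) [∀ ω, DecidablePred (· ∈ B ω)] {η : ℝ≥0∞} (h : ∀ ω, prob q (B ω) ≤ η) :
    prob q {a | Fintype.card Ω ≤ 2 * (Finset.univ.filter fun ω => a ∈ B ω).card} ≤ 2 * η := by
  classical
  have hΩ : (Fintype.card Ω : ℝ≥0∞) ≠ 0 := by simp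
  have hΩ' : (Fintype.card Ω : ℝ≥0∞) ≠ ⊤ := ENNReal.natCast_ne_top _
  rw [← ENNReal.mul_le_mul_iff_right hΩ hΩ']
  calc _ = ∑ a, if a ∈ {a | Fintype.card Ω ≤ 2 * (Finset.univ.filter fun ω => a ∈ B ω).card}
          then (Fintype.card Ω : ℝ≥0∞) * q a else 0 := by
        rw [prob_eq_sum, Finset.mul_sum]; simp [mul_ite]
    _ ≤ ∑ a, 2 * ∑ ω, if a ∈ B ω then q a else 0 := by
        refine Finset.sum_le_sum fun a _ => ?_
        split_ifs with ha
        · rw [← Finset.sum_filter, Finset.sum_const, nsmul_eq_mul, ← mul_assoc]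
          gcongr
          exact_mod_cast ha
        · exact zero_le
    _ = 2 * ∑ ω, prob q (B ω) := by
        rw [← Finset.mul_sum, Finset.sum_comm]; simp_rw [prob_eq_sum]
    _ ≤ 2 * ∑ _ω : Ω, η := by gcongr; exact h _
    _ = _ := by simp; ring

/-! ### Satisfiability from Hall's condition, and wide clauses in refutations -/

/-- The assignment `a` satisfies the clause `C`. -/
def Clause.SatBy {n : ℕ} (C : Clause n) (a : Fin n → Bool) : Prop := ∃ l ∈ C, a l.1 = l.2

/-- The partial assignment `a₀` on `T` satisfies the clause `C`. -/
def Clause.Killed {n : ℕ} (C : Clause n) (T : Finset (Fin n)) (a₀ : Fin n → Bool) : Prop :=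
  ∃ l ∈ C, l.1 ∈ T ∧ a₀ l.1 = l.2

/-- The variables outside `T` that occur in the clauses of `φ` with index in `R`. -/
def Formula.varsOutside {n m : ℕ} (φ : Formula n m) (T : Finset (Fin n)) (R : Finset (Fin m)) :
    Finset (Fin n) := R.biUnion fun i => (φ i).vars \ T

/-- Every assignment that agrees with `a₀` on `T` and satisfies the clauses of `φ` with index in
`R` satisfies `D`. -/
def Formula.ImpliesOn {n m : ℕ} (φ : Formula n m) (T : Finset (Fin n)) (a₀ : Fin n → Bool)
    (R : Finset (Fin m)) (D : Clause n) : Prop :=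
  ∀ a : Fin n → Bool, (∀ v ∈ T, a v = a₀ v) → (∀ i ∈ R, (φ i).SatBy a) → D.SatBy a

theorem Clause.mem_vars {n : ℕ} {C : Clause n} {v : Fin n} : v ∈ C.vars ↔ ∃ b, (v, b) ∈ C := by
  simp [Clause.vars]

theorem Clause.card_vars_le {n : ℕ} (C : Clause n) : C.vars.card ≤ C.card :=
  Finset.card_image_le

/-- Hall's theorem gives each clause a variable of its own outside `T`, which is set so as to
satisfy the clause. -/
theorem Formula.exists_satBy_of_hall {n m : ℕ} (φ : Formula n m) (T : Finset (Fin n))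
    (a₀ : Fin n → Bool) (R : Finset (Fin m))
    (h : ∀ R' ⊆ R, R'.card ≤ (φ.varsOutside T R').card) :
    ∃ a : Fin n → Bool, (∀ v ∈ T, a v = a₀ v) ∧ ∀ i ∈ R, (φ i).SatBy a := by
  classical
  have hall : ∀ s : Finset R, s.card ≤ (s.biUnion fun i => (φ i.1).vars \ T).card := by
    intro s
    have := h (s.image Subtype.val) (by
      intro i hi
      obtain ⟨j, -, rfl⟩ := Finset.mem_image.1 hi
      exact j.2)
    rwa [Finset.card_image_of_injective _ Subtype.val_injective, varsOutside,
      Finset.image_biUnion] at this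
  obtain ⟨f, hinj, hf⟩ := (Finset.all_card_le_biUnion_card_iff_exists_injective _).1 hall
  have hf1 : ∀ i : R, ∃ b, (f i, b) ∈ φ i.1 := fun i =>
    Clause.mem_vars.1 (Finset.mem_sdiff.1 (hf i)).1
  have hf2 : ∀ i : R, f i ∉ T := fun i => (Finset.mem_sdiff.1 (hf i)).2
  choose b hb using hf1
  refine ⟨fun v => if hv : ∃ i, f i = v then b hv.choose else a₀ v, ?_, ?_⟩
  · intro v hv
    have : ¬ ∃ i, f i = v := by
      rintro ⟨i, rfl⟩; exact hf2 i hv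
    simp [this]
  · intro i hi
    have hv : ∃ j, f j = f ⟨i, hi⟩ := ⟨_, rfl⟩
    refine ⟨(f ⟨i, hi⟩, b ⟨i, hi⟩), hb ⟨i, hi⟩, ?_⟩
    have : hv.choose = ⟨i, hi⟩ := hinj hv.choose_spec
    simp only [hv, dif_pos]
    rw [this]

theorem Resolves.satBy {n : ℕ} {C D E : Clause n} (h : Resolves C D E) {a : Fin n → Bool}
    (hC : C.SatBy a) (hD : D.SatBy a) : E.SatBy a := by
  obtain ⟨v, W, U, rfl, rfl, rfl⟩ := h
  obtain ⟨l, hl, hal⟩ := hC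
  obtain ⟨l', hl', hal'⟩ := hD
  rcases Finset.mem_insert.1 hl with rfl | hl
  · rcases Finset.mem_insert.1 hl' with rfl | hl'
    · simp_all
    · exact ⟨l', Finset.mem_union_right _ hl', hal'⟩
  · exact ⟨l, Finset.mem_union_left _ hl, hal⟩

/-- A variable outside `T` that occurs in exactly one clause of a minimal implying set `R` occurs in
the implied clause: otherwise an assignment falsifying only that clause of `R` and the implied
clause could be flipped there. -/
theorem Formula.mem_vars_of_minimal {n m : ℕ} (φ : Formula n m) (T : Finset (Fin n))
    (a₀ : Fin n → Bool) (R : Finset (Fin m)) (D : Clause n) (hR : φ.ImpliesOn T a₀ R D)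
    (hmin : ∀ j ∈ R, ¬ φ.ImpliesOn T a₀ (R.erase j) D) {v : Fin n} (hvT : v ∉ T) {j : Fin m}
    (hj : j ∈ R) (hvj : v ∈ (φ j).vars) (huniq : ∀ i ∈ R, v ∈ (φ i).vars → i = j) :
    v ∈ D.vars := by
  classical
  have h := hmin j hj
  simp only [ImpliesOn, not_forall] at h
  obtain ⟨a, haT, haR, haD⟩ := h
  obtain ⟨b, hb⟩ := Clause.mem_vars.1 hvj
  have hsat : D.SatBy (Function.update a v b) := by
    refine hR _ ?_ ?_
    · intro w hw
      have : w ≠ v := by rintro rfl; exact hvT hw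
      simp [this, haT w hw]
    · intro i hi
      by_cases hij : i = j
      · subst hij
        exact ⟨(v, b), hb, by simp⟩
      · obtain ⟨l, hl, hal⟩ := haR i (Finset.mem_erase.2 ⟨hij, hi⟩)
        have : l.1 ≠ v := by
          intro hlv
          exact hij (huniq i hi (Clause.mem_vars.2 ⟨l.2, hlv ▸ hl⟩))
        exact ⟨l, hl, by simp [this, hal]⟩
  obtain ⟨l, hl, hal⟩ := hsat
  by_cases hlv : l.1 = v
  · exact Clause.mem_vars.2 ⟨l.2, hlv ▸ hl⟩
  · exact absurd ⟨l, hl, by simpa [hlv] using hal⟩ haD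

/-- Double counting of occurrences: `r` sets of size at most `k` that cover `u` points have at least
`2 u - k r` points that are covered exactly once. -/
theorem two_mul_card_biUnion_le {ι α : Type} [DecidableEq ι] [DecidableEq α] (R : Finset ι)
    (F : ι → Finset α) (k : ℕ) (hF : ∀ i ∈ R, (F i).card ≤ k) :
    2 * (R.biUnion F).card ≤
      k * R.card + ((R.biUnion F).filter fun v => (R.filter fun i => v ∈ F i).card = 1).card := by
  have h1 : ∑ i ∈ R, (F i).card = ∑ v ∈ R.biUnion F, (R.filter fun i => v ∈ F i).card := by
    refine Eq.trans (Finset.sum_congr rfl fun i hi => ?_)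
      (Finset.sum_card_bipartiteAbove_eq_sum_card_bipartiteBelow (s := R) (t := R.biUnion F)
        (fun i v => v ∈ F i))
    congr 1
    ext v
    simp only [Finset.bipartiteAbove, Finset.mem_filter, Finset.mem_biUnion]
    exact ⟨fun h => ⟨⟨i, hi, h⟩, h⟩, fun h => h.2⟩
  have h2 : ∑ i ∈ R, (F i).card ≤ k * R.card := by
    rw [mul_comm, ← smul_eq_mul]
    exact Finset.sum_le_card_nsmul R _ k hF
  rw [Finset.card_filter]
  calc 2 * (R.biUnion F).card = ∑ v ∈ R.biUnion F, 2 := by simp [mul_comm]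
    _ ≤ ∑ v ∈ R.biUnion F, ((R.filter fun i => v ∈ F i).card +
          if (R.filter fun i => v ∈ F i).card = 1 then 1 else 0) := by
        refine Finset.sum_le_sum fun v hv => ?_
        obtain ⟨i, hi, hvi⟩ := Finset.mem_biUnion.1 hv
        have : 0 < (R.filter fun i => v ∈ F i).card :=
          Finset.card_pos.2 ⟨i, Finset.mem_filter.2 ⟨hi, hvi⟩⟩
        split_ifs <;> omega
    _ ≤ _ := by rw [Finset.sum_add_distrib, ← h1]; omega

/-- The expansion of a formula relative to a set `T` of fixed variables: all clauses have at most
`k` variables, sets of at most `r₀` clauses satisfy Hall's condition outside `T`, and sets of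
between `r₀ / 2` and `r₀` clauses have more than `(k + ε) / 2` variables per clause outside `T`. -/
structure Formula.Expands {n m : ℕ} (φ : Formula n m) (k : ℕ) (ε r₀ : ℝ) (T : Finset (Fin n)) :
    Prop where
  width : ∀ i, (φ i).vars.card ≤ k
  hall : ∀ R : Finset (Fin m), (R.card : ℝ) ≤ r₀ → R.card ≤ (φ.varsOutside T R).card
  large : ∀ R : Finset (Fin m), r₀ / 2 < R.card → (R.card : ℝ) ≤ r₀ →
    R.card * ((k + ε) / 2) < ((φ.varsOutside T R).card : ℝ)

/-- In a refutation of an expanding formula, the first clause that is not implied by `r₀ / 2`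
clauses of the formula is wide, and the restriction does not satisfy it. -/
theorem Formula.Expands.exists_wide {n m : ℕ} {φ : Formula n m} {k : ℕ} {ε r₀ : ℝ}
    {T : Finset (Fin n)} (h : φ.Expands k ε r₀ T) (hε : 0 < ε) (hr₀ : 2 ≤ r₀) (a₀ : Fin n → Bool)
    {s : ℕ} {P : Fin s → Clause n} (hP : IsRefutation φ P) :
    ∃ i, ¬ (P i).Killed T a₀ ∧ ε * r₀ / 2 ≤ ((P i).card : ℝ) := by
  classical
  obtain ⟨hder, i₀, hi₀⟩ := hP
  let Q : Fin s → Prop := fun i => ∃ R : Finset (Fin m), (R.card : ℝ) ≤ r₀ / 2 ∧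
    φ.ImpliesOn T a₀ R (P i)
  have hex : ∃ i, ¬ Q i := by
    refine ⟨i₀, ?_⟩
    rintro ⟨R, hR, himp⟩
    obtain ⟨a, haT, haR⟩ := φ.exists_satBy_of_hall T a₀ R fun R' hR' => h.hall R' (by
      have : (R'.card : ℝ) ≤ R.card := by exact_mod_cast Finset.card_le_card hR'
      linarith)
    obtain ⟨l, hl, -⟩ := himp a haT haR
    simp [hi₀] at hl
  -- `P i` is the first clause not implied by `r₀ / 2` clauses; its parents are, so `r₀` suffice
  obtain ⟨i, hi, hmin⟩ := WellFounded.has_min (wellFounded_lt (α := Fin s)) {i | ¬ Q i} hex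
  have hmin' : ∀ j < i, Q j := fun j hj => by
    by_contra hQ
    exact hmin j hQ hj
  have himp : ∃ R : Finset (Fin m), (R.card : ℝ) ≤ r₀ ∧ φ.ImpliesOn T a₀ R (P i) := by
    rcases hder i with ⟨j, hj⟩ | ⟨a, ha, b, hb, hres⟩
    · refine ⟨{j}, by simp; linarith, fun a _ haR => hj ▸ haR j (by simp)⟩
    · obtain ⟨Ra, hRa, hia⟩ := hmin' a ha
      obtain ⟨Rb, hRb, hib⟩ := hmin' b hb
      refine ⟨Ra ∪ Rb, ?_, fun a haT haR => hres.satBy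
        (hia a haT fun i hi => haR i (Finset.mem_union_left _ hi))
        (hib a haT fun i hi => haR i (Finset.mem_union_right _ hi))⟩
      have : ((Ra ∪ Rb).card : ℝ) ≤ Ra.card + Rb.card := by
        exact_mod_cast Finset.card_union_le _ _
      linarith
  -- all points covered once by a minimal such set of clauses are variables of `P i`
  obtain ⟨R, ⟨hRr, hR⟩, hRmin⟩ := WellFounded.has_min
    (measure (fun R : Finset (Fin m) => R.card)).wf
    {R | (R.card : ℝ) ≤ r₀ ∧ φ.ImpliesOn T a₀ R (P i)} himp
  have hRlarge : r₀ / 2 < R.card := by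
    by_contra hcon
    exact hi ⟨R, not_lt.1 hcon, hR⟩
  refine ⟨i, ?_, ?_⟩
  · rintro ⟨l, hl, hlT, hal⟩
    exact hi ⟨∅, by simp; linarith, fun a haT _ => ⟨l, hl, (haT _ hlT).trans hal⟩⟩
  · have herase : ∀ j ∈ R, ¬ φ.ImpliesOn T a₀ (R.erase j) (P i) := by
      intro j hj hcon
      have hlt := Finset.card_erase_lt_of_mem hj
      refine hRmin (R.erase j) ⟨?_, hcon⟩ hlt
      have : ((R.erase j).card : ℝ) ≤ R.card := by exact_mod_cast hlt.le
      linarith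
    have hb := two_mul_card_biUnion_le R (fun i => (φ i).vars \ T) k fun i _ =>
      (Finset.card_le_card Finset.sdiff_subset).trans (h.width i)
    set B := (R.biUnion fun i => (φ i).vars \ T).filter fun v =>
      (R.filter fun i => v ∈ (φ i).vars \ T).card = 1 with hB
    have hBsub : B ⊆ (P i).vars := by
      intro v hv
      obtain ⟨-, hv1⟩ := Finset.mem_filter.1 hv
      obtain ⟨j, hj⟩ := Finset.card_eq_one.1 hv1
      have hjm : j ∈ R.filter fun i => v ∈ (φ i).vars \ T := by rw [hj]; simp
      simp only [Finset.mem_filter, Finset.mem_sdiff] at hjm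
      refine φ.mem_vars_of_minimal T a₀ R (P i) hR herase hjm.2.2 hjm.1 hjm.2.1 ?_
      intro i' hi' hvi'
      have : i' ∈ R.filter fun i => v ∈ (φ i).vars \ T := by
        simp [hi', hvi', hjm.2.2]
      rw [hj] at this
      simpa using this
    have hBc : (B.card : ℝ) ≤ (P i).card := by
      exact_mod_cast (Finset.card_le_card hBsub).trans (Clause.card_vars_le _)
    have hb' : 2 * ((φ.varsOutside T R).card : ℝ) ≤ k * R.card + B.card := by exact_mod_cast hb
    have hl := h.large R hRlarge hRr
    nlinarith

/-! ### The distribution of a random clause -/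

/-- A `k`-set of variables carries `2 ^ k` clauses. -/
theorem card_kClauses_filter_vars_eq {n k : ℕ} {V : Finset (Fin n)} (hV : V.card = k) :
    ((kClauses n k).filter fun C => C.vars = V).card = 2 ^ k := by
  classical
  rw [← hV, ← Finset.card_powerset]
  symm
  refine Finset.card_bij (fun U _ => V.image fun v => (v, decide (v ∈ U))) ?_ ?_ ?_
  · intro U hU
    have hv : Clause.vars (V.image fun v => (v, decide (v ∈ U))) = V := by
      simp [Clause.vars, Finset.image_image, Function.comp_def]
    simp only [Finset.mem_filter, kClauses, Finset.mem_univ, true_and, hv, hV, and_true]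
    rw [Finset.card_image_of_injective _ fun a b hab => by simpa using congrArg Prod.fst hab, hV]
  · intro U hU U' hU' h
    rw [Finset.mem_powerset] at hU hU'
    ext v
    have key : ∀ U : Finset (Fin n), U ⊆ V →
        (v ∈ U ↔ (v, true) ∈ V.image fun v => (v, decide (v ∈ U))) := by
      intro U hU
      simp only [Finset.mem_image, Prod.mk.injEq, decide_eq_true_eq]
      exact ⟨fun h => ⟨v, hU h, rfl, h⟩, by rintro ⟨w, -, rfl, h⟩; exact h⟩
    rw [key U hU, key U' hU', h]
  · intro C hC
    simp only [Finset.mem_filter, kClauses, Finset.mem_univ, true_and] at hC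
    obtain ⟨⟨hCk, hCv⟩, rfl⟩ := hC
    -- a clause with as many variables as literals has one literal per variable
    have hinj : Set.InjOn Prod.fst (C : Set (Literal n)) :=
      Finset.card_image_iff.1 (by rw [hCk]; exact hCv)
    refine ⟨(C.filter fun l => l.2 = true).image Prod.fst, ?_, ?_⟩
    · rw [Finset.mem_powerset]
      exact Finset.image_subset_image (Finset.filter_subset _ _)
    · ext ⟨v, b⟩
      have hmem : ∀ b, (v, b) ∈ C →
          (v ∈ (C.filter fun l => l.2 = true).image Prod.fst ↔ b = true) := by
        intro b hb
        simp only [Finset.mem_image, Finset.mem_filter]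
        constructor
        · rintro ⟨l, ⟨hl, hl2⟩, hlv⟩
          rw [← hl2, ← hinj hb hl hlv.symm]
        · rintro rfl
          exact ⟨(v, true), ⟨hb, rfl⟩, rfl⟩
      rw [Finset.mem_image]
      constructor
      · rintro ⟨w, hw, h⟩
        obtain ⟨rfl, hd⟩ := Prod.mk.inj h
        obtain ⟨b', hb'⟩ : ∃ b', (w, b') ∈ C := by simpa [Clause.vars] using hw
        have : b = b' := by
          rw [← hd]
          cases b' <;> simp [hmem _ hb']
        rwa [this]
      · intro hb
        refine ⟨v, by simp only [Clause.vars, Finset.mem_image]; exact ⟨_, hb, rfl⟩, ?_⟩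
        have := hmem b hb
        cases b <;> simp_all

/-- The clauses whose variable sets belong to a family `H` of `k`-sets. -/
theorem card_kClauses_filter_vars_mem {n k : ℕ} {H : Finset (Finset (Fin n))}
    (hH : ∀ V ∈ H, V.card = k) :
    ((kClauses n k).filter fun C => C.vars ∈ H).card = H.card * 2 ^ k := by
  classical
  rw [Finset.card_eq_sum_card_fiberwise (f := Clause.vars) (t := H)
    (fun C hC => Finset.mem_coe.2 (Finset.mem_filter.1 hC).2), Finset.sum_const_nat]
  intro V hV
  rw [← card_kClauses_filter_vars_eq (hH V hV), Finset.filter_filter]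
  congr 1
  ext C
  simp only [Finset.mem_filter]
  exact ⟨fun h => ⟨h.1, h.2.2⟩, fun h => ⟨h.1, h.2 ▸ hV, h.2⟩⟩

/-- The chance that the variable set of a uniformly random clause with variable set in `H` lies in
`F` is at most `#F / #H`. -/
theorem prob_uniformOn_kClauses_le {n k : ℕ} {H F : Finset (Finset (Fin n))}
    (hH : ∀ V ∈ H, V.card = k) (hF : ∀ V ∈ F, V.card = k) {G : Finset (Clause n)}
    (hG : G = (kClauses n k).filter fun C => C.vars ∈ H) (hne : G.Nonempty) {E : Set (Clause n)}
    (hE : ∀ C ∈ kClauses n k, C ∈ E → C.vars ∈ F) :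
    prob (uniformOn G) E ≤ ENNReal.ofReal ((F.card : ℝ) / H.card) := by
  classical
  have hGc : G.card = H.card * 2 ^ k := hG ▸ card_kClauses_filter_vars_mem hH
  have hH0 : 0 < H.card := by
    have := hne.card_pos
    rw [hGc] at this
    exact Nat.pos_of_mul_pos_right this
  rw [prob_uniformOn hne, hGc, ENNReal.ofReal_div_of_pos (by exact_mod_cast hH0),
    ENNReal.ofReal_natCast, ENNReal.ofReal_natCast]
  have hle : (G.filter (· ∈ E)).card ≤ F.card * 2 ^ k := by
    rw [← card_kClauses_filter_vars_mem hF]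
    refine Finset.card_le_card fun C hC => ?_
    rw [Finset.mem_filter, hG, Finset.mem_filter] at hC
    exact Finset.mem_filter.2 ⟨hC.1.1, hE C hC.1.1 hC.2⟩
  calc ((G.filter (· ∈ E)).card : ℝ≥0∞) / ((H.card * 2 ^ k : ℕ) : ℝ≥0∞)
      ≤ ((F.card * 2 ^ k : ℕ) : ℝ≥0∞) / ((H.card * 2 ^ k : ℕ) : ℝ≥0∞) := by gcongr
    _ = _ := by
      push_cast
      exact ENNReal.mul_div_mul_right _ _ (by positivity) (by finiteness)

/-- The number of `k`-sets of variables within one community. -/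
theorem card_within_sets {n k c : ℕ} (hk : 0 < k) {S : Finpartition (Finset.univ : Finset (Fin n))}
    (hS : S ∈ communityPartitions n c) :
    ((Finset.univ.powersetCard k).filter fun V : Finset (Fin n) => ∃ A ∈ S.parts, V ⊆ A).card =
      c * (n / c).choose k := by
  classical
  simp only [communityPartitions, Finset.mem_filter, Finset.mem_univ, true_and] at hS
  have : ((Finset.univ.powersetCard k).filter fun V : Finset (Fin n) => ∃ A ∈ S.parts, V ⊆ A) =
      S.parts.biUnion fun A => A.powersetCard k := by
    ext V
    simp only [Finset.mem_filter, Finset.mem_powersetCard, Finset.subset_univ, true_and,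
      Finset.mem_biUnion]
    exact ⟨fun ⟨h, A, hA, hV⟩ => ⟨A, hA, hV, h⟩, fun ⟨A, hA, hV, h⟩ => ⟨h, A, hA, hV⟩⟩
  rw [this, Finset.card_biUnion, Finset.sum_congr rfl fun A hA => by
    rw [Finset.card_powersetCard, hS.2 A hA], Finset.sum_const, hS.1, smul_eq_mul]
  intro A hA B hB hAB
  rw [Function.onFun, Finset.disjoint_left]
  intro V hVA hVB
  rw [Finset.mem_powersetCard] at hVA hVB
  obtain ⟨v, hv⟩ := Finset.card_pos.1 (hVA.2.symm ▸ hk)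
  exact hAB (S.eq_of_mem_parts hA hB (hVA.1 hv) (hVB.1 hv))

/-- The number of `k`-sets of variables that are in different communities: there are at least as
many as choices of `k` communities with a variable in each. -/
theorem le_card_bridge_sets {n k c : ℕ} {S : Finpartition (Finset.univ : Finset (Fin n))}
    (hS : S ∈ communityPartitions n c) :
    c.choose k * (n / c) ^ k ≤ ((Finset.univ.powersetCard k).filter fun V : Finset (Fin n) =>
      ∀ A ∈ S.parts, (V ∩ A).card ≤ 1).card := by
  classical
  simp only [communityPartitions, Finset.mem_filter, Finset.mem_univ, true_and] at hS
  let J := (S.parts.powersetCard k).sigma fun Q => Q.pi fun A => A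
  have hJ : J.card = c.choose k * (n / c) ^ k := by
    rw [Finset.card_sigma, Finset.sum_congr rfl (g := fun _ => (n / c) ^ k), Finset.sum_const,
      Finset.card_powersetCard, hS.1, smul_eq_mul]
    intro Q hQ
    rw [Finset.mem_powersetCard] at hQ
    rw [Finset.card_pi, Finset.prod_congr rfl fun A hA => hS.2 A (hQ.1 hA), Finset.prod_const, hQ.2]
  let im : (Σ Q : Finset (Finset (Fin n)), ∀ A ∈ Q, Fin n) → Finset (Fin n) := fun q =>
    q.1.attach.image fun A => q.2 A.1 A.2
  have hmem : ∀ q ∈ J, q.1 ⊆ S.parts ∧ q.1.card = k ∧ ∀ A (hA : A ∈ q.1), q.2 A hA ∈ A := by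
    rintro ⟨Q, f⟩ hq
    simp only [J, Finset.mem_sigma, Finset.mem_powersetCard, Finset.mem_pi] at hq
    exact ⟨hq.1.1, hq.1.2, hq.2⟩
  have huniq : ∀ q ∈ J, ∀ A ∈ S.parts, ∀ v ∈ im q, v ∈ A → ∃ hA : A ∈ q.1, v = q.2 A hA := by
    intro q hq A hA v hv hvA
    obtain ⟨hsub, -, hf⟩ := hmem q hq
    simp only [im, Finset.mem_image, Finset.mem_attach, true_and] at hv
    obtain ⟨B, rfl⟩ := hv
    obtain rfl := S.eq_of_mem_parts (hsub B.2) hA (hf B.1 B.2) hvA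
    exact ⟨B.2, rfl⟩
  rw [← hJ]
  refine Finset.card_le_card_of_injOn im ?_ ?_
  · intro q hq
    obtain ⟨hsub, hcard, hf⟩ := hmem q hq
    simp only [Finset.coe_filter, Finset.mem_powersetCard, Finset.subset_univ, true_and,
      Set.mem_ofPred_eq]
    refine ⟨?_, fun A hA => Finset.card_le_one.2 fun v hv w hw => ?_⟩
    · rw [Finset.card_image_of_injective, Finset.card_attach, hcard]
      intro A B hAB
      dsimp only at hAB
      exact Subtype.ext (S.eq_of_mem_parts (hsub A.2) (hsub B.2) (hf _ A.2) (hAB ▸ hf _ B.2))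
    · rw [Finset.mem_inter] at hv hw
      obtain ⟨_, rfl⟩ := huniq q hq A hA v hv.1 hv.2
      obtain ⟨_, rfl⟩ := huniq q hq A hA w hw.1 hw.2
      rfl
  · intro q hq q' hq' h
    obtain ⟨hsub, hcard, hf⟩ := hmem q hq
    obtain ⟨hsub', hcard', hf'⟩ := hmem q' hq'
    have him : ∀ A (hA : A ∈ q.1), q.2 A hA ∈ im q := fun A hA =>
      Finset.mem_image.2 ⟨⟨A, hA⟩, Finset.mem_attach _ _, rfl⟩
    have h1 : ∀ A (hA : A ∈ q.1), ∃ hA' : A ∈ q'.1, q.2 A hA = q'.2 A hA' := fun A hA =>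
      huniq q' hq' A (hsub hA) _ (h ▸ him A hA) (hf A hA)
    have h2 : q.1 = q'.1 :=
      Finset.eq_of_subset_of_card_le (fun A hA => (h1 A hA).1) (by rw [hcard, hcard'])
    obtain ⟨Q, f⟩ := q
    obtain ⟨Q', f'⟩ := q'
    obtain rfl : Q = Q' := h2
    congr 1
    funext A hA
    exact (h1 A hA).2

/-- The chance that a random clause has its variable set in a family `F` of `k`-sets is at most
`κ c ^ (k - 1)` times what it is for a uniformly random `k`-set, where `κ` bounds the ratio of
`n.choose k` and `c ^ k * (n / c).choose k`. -/
theorem prob_clauseDist_le {n k c : ℕ} (p : unitInterval) (hadm : AdmissibleParams k n c) {κ : ℝ}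
    (hκ : 1 ≤ κ) (hch : (n.choose k : ℝ) ≤ κ * (c : ℝ) ^ k * ((n / c).choose k : ℕ))
    {S : Finpartition (Finset.univ : Finset (Fin n))} (hS : S ∈ communityPartitions n c)
    {F : Finset (Finset (Fin n))} (hF : ∀ V ∈ F, V.card = k) {E : Set (Clause n)}
    (hE : ∀ C ∈ kClauses n k, C ∈ E → C.vars ∈ F) :
    prob (clauseDist k p S) E ≤
      ENNReal.ofReal (κ * (c : ℝ) ^ (k - 1) * (F.card / n.choose k)) := by
  classical
  have hk2 := hadm.2.1
  have hkc := hadm.2.2.1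
  have hmul := hadm.mul_le
  have hn : k ≤ n := le_trans (Nat.le_mul_of_pos_left k (by omega)) hmul
  have hc0 : (0 : ℝ) < c := by exact_mod_cast (by omega : 0 < c)
  have hch0 : (0 : ℝ) < n.choose k := by exact_mod_cast Nat.choose_pos hn
  have key : ∀ H : ℝ, n.choose k ≤ κ * (c : ℝ) ^ (k - 1) * H →
      (F.card : ℝ) / H ≤ κ * (c : ℝ) ^ (k - 1) * (F.card / n.choose k) := by
    intro H hH
    have hH0 : 0 < H := by
      by_contra hcon
      have : κ * (c : ℝ) ^ (k - 1) * H ≤ 0 :=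
        mul_nonpos_of_nonneg_of_nonpos (by positivity) (not_lt.1 hcon)
      linarith
    rw [div_le_iff₀ hH0, mul_assoc, mul_comm ((F.card : ℝ) / _), ← mul_assoc, ← mul_div_assoc,
      le_div_iff₀ hch0, mul_comm]
    gcongr
  have hkp : (c : ℝ) ^ k = c ^ (k - 1) * c := by rw [← pow_succ]; congr 1; omega
  refine prob_bind_le fun b _ => ?_
  cases b
  · simp only [Bool.false_eq_true, if_false]
    refine (prob_uniformOn_kClauses_le
      (H := (Finset.univ.powersetCard k).filter fun V : Finset (Fin n) =>
        ∀ A ∈ S.parts, (V ∩ A).card ≤ 1) (fun V hV => by simp at hV; exact hV.1) hF ?_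
      (bridgeClauses_nonempty hadm hS) hE).trans (ENNReal.ofReal_le_ofReal (key _ ?_))
    · ext C
      simp only [bridgeClauses, Finset.mem_filter, Finset.mem_powersetCard, Finset.subset_univ,
        true_and, kClauses, Finset.mem_univ]
      tauto
    · have h1 := le_card_bridge_sets (k := k) hS
      set H := ((Finset.univ.powersetCard k).filter fun V : Finset (Fin n) =>
        ∀ A ∈ S.parts, (V ∩ A).card ≤ 1).card
      -- `n.choose k ≤ n ^ k / k!`, while `c ≤ c.descFactorial k = k! * c.choose k`
      have h2 : (n.choose k : ℝ) ≤ n ^ k / k.factorial := Nat.choose_le_pow_div _ _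
      have h3 : c ≤ c.choose k * k.factorial := by
        rw [mul_comm, ← Nat.descFactorial_eq_factorial_mul_choose]
        obtain ⟨j, rfl⟩ : ∃ j, k = j + 1 := ⟨k - 1, by omega⟩
        obtain ⟨e, rfl⟩ : ∃ e, c = e + 1 := ⟨c - 1, by omega⟩
        rw [Nat.succ_descFactorial_succ]
        exact Nat.le_mul_of_pos_right _ (Nat.pos_of_ne_zero
          (by rw [Ne, Nat.descFactorial_eq_zero_iff_lt]; omega))
      have h4 : (n : ℝ) = c * (n / c : ℕ) := by
        exact_mod_cast (Nat.mul_div_cancel' hadm.1).symm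
      have h1' : (c.choose k : ℝ) * (n / c : ℕ) ^ k ≤ H := by exact_mod_cast h1
      have h3' : (c : ℝ) ≤ c.choose k * k.factorial := by exact_mod_cast h3
      calc (n.choose k : ℝ) ≤ n ^ k / k.factorial := h2
        _ = c ^ (k - 1) * c * (n / c : ℕ) ^ k / k.factorial := by rw [h4, mul_pow, hkp]
        _ ≤ c ^ (k - 1) * (c.choose k * k.factorial) * (n / c : ℕ) ^ k / k.factorial := by gcongr
        _ = 1 * c ^ (k - 1) * (c.choose k * (n / c : ℕ) ^ k) := by field_simp
        _ ≤ κ * c ^ (k - 1) * H := by gcongr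
  · simp only [if_true]
    refine (prob_uniformOn_kClauses_le
      (H := (Finset.univ.powersetCard k).filter fun V : Finset (Fin n) =>
        ∃ A ∈ S.parts, V ⊆ A) (fun V hV => by simp at hV; exact hV.1) hF ?_
      (withinClauses_nonempty hadm hS) hE).trans (ENNReal.ofReal_le_ofReal (key _ ?_))
    · ext C
      simp only [withinClauses, Finset.mem_filter, Finset.mem_powersetCard, Finset.subset_univ,
        true_and, kClauses, Finset.mem_univ]
      tauto
    · rw [card_within_sets (by omega) hS]
      push_cast
      rw [hkp] at hch
      linarith

/-! ### Counting sets of variables -/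

theorem choose_mul_pow_le {a n : ℕ} (h : a ≤ n) (j : ℕ) :
    a.choose j * n ^ j ≤ n.choose j * a ^ j := by
  have key : a.descFactorial j * n ^ j ≤ n.descFactorial j * a ^ j := by
    induction j with
    | zero => simp
    | succ j ih =>
      rw [Nat.descFactorial_succ, Nat.descFactorial_succ, pow_succ, pow_succ]
      have : (a - j) * n ≤ (n - j) * a := by
        rw [Nat.sub_mul, Nat.sub_mul, mul_comm n a]
        exact Nat.sub_le_sub_left (Nat.mul_le_mul_left j h) _
      calc _ = (a.descFactorial j * n ^ j) * ((a - j) * n) := by ring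
        _ ≤ (n.descFactorial j * a ^ j) * ((n - j) * a) := Nat.mul_le_mul ih this
        _ = _ := by ring
  rw [Nat.descFactorial_eq_factorial_mul_choose, Nat.descFactorial_eq_factorial_mul_choose,
    mul_assoc, mul_assoc] at key
  exact Nat.le_of_mul_le_mul_left key j.factorial_pos

/-- The fraction of the `k`-sets that are contained in `B` and have at least `j` elements in
`A ⊆ B`: such a set consists of `j` elements of `A` and `k - j` other elements of `B`. -/
theorem card_sets_le {n k j : ℕ} (hk : 0 < k) (hjk : j ≤ k) (hkn : k ≤ n) {A B : Finset (Fin n)}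
    (hAB : A ⊆ B) :
    (((Finset.univ.powersetCard k).filter fun V : Finset (Fin n) =>
      V ⊆ B ∧ j ≤ (V ∩ A).card).card : ℝ) / n.choose k ≤
      k.choose j * ((A.card : ℝ) / n) ^ j * ((B.card : ℝ) / n) ^ (k - j) := by
  classical
  have hn : 0 < n := hk.trans_le hkn
  have hBn : B.card ≤ n := by simpa using Finset.card_le_univ B
  have hAn : A.card ≤ n := (Finset.card_le_card hAB).trans hBn
  have h1 : ((Finset.univ.powersetCard k).filter fun V : Finset (Fin n) =>
      V ⊆ B ∧ j ≤ (V ∩ A).card).card ≤ A.card.choose j * (B.card - j).choose (k - j) := by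
    calc _ ≤ ((A.powersetCard j).biUnion fun U =>
          ((B \ U).powersetCard (k - j)).image (U ∪ ·)).card := by
          refine Finset.card_le_card fun V hV => ?_
          simp only [Finset.mem_filter, Finset.mem_powersetCard, Finset.subset_univ,
            true_and] at hV
          obtain ⟨U, hU, hUj⟩ := Finset.exists_subset_card_eq hV.2.2
          simp only [Finset.mem_biUnion, Finset.mem_image, Finset.mem_powersetCard]
          have hUV : U ⊆ V := hU.trans Finset.inter_subset_left
          exact ⟨U, ⟨hU.trans Finset.inter_subset_right, hUj⟩, V \ U,
            ⟨Finset.sdiff_subset_sdiff hV.2.1 subset_rfl, by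
              rw [Finset.card_sdiff_of_subset hUV, hV.1, hUj]⟩, by simpa using hUV⟩
      _ ≤ _ := by
          refine (Finset.card_biUnion_le_card_mul _ _ ((B.card - j).choose (k - j)) ?_).trans
            (by rw [Finset.card_powersetCard])
          intro U hU
          rw [Finset.mem_powersetCard] at hU
          refine Finset.card_image_le.trans ?_
          rw [Finset.card_powersetCard, Finset.card_sdiff_of_subset (hU.1.trans hAB), hU.2]
  have h2 := choose_mul_pow_le hAn j
  have h3 := choose_mul_pow_le (Nat.sub_le_sub_right hBn j) (k - j)
  have h4 := Nat.choose_mul (n := n) hjk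
  by_cases hjB : j ≤ B.card
  swap
  · have : A.card.choose j = 0 := Nat.choose_eq_zero_of_lt
      (lt_of_le_of_lt (Finset.card_le_card hAB) (by omega))
    rw [this, zero_mul, Nat.le_zero] at h1
    rw [h1]
    simp only [Nat.cast_zero, zero_div]
    positivity
  have hn' : (0 : ℝ) < n := by exact_mod_cast hn
  have hch0 : (0 : ℝ) < n.choose k := by exact_mod_cast Nat.choose_pos hkn
  have hA : (A.card.choose j : ℝ) ≤ n.choose j * ((A.card : ℝ) / n) ^ j := by
    rw [div_pow, ← mul_div_assoc, le_div_iff₀ (by positivity)]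
    exact_mod_cast h2
  -- `(b - j) / (n - j) ≤ b / n`
  have hB : ((B.card - j).choose (k - j) : ℝ) ≤
      (n - j).choose (k - j) * ((B.card : ℝ) / n) ^ (k - j) := by
    rcases Nat.eq_zero_or_pos (n - j) with h0 | h0
    · have : k - j = 0 := by omega
      simp [this]
    have h0' : (0 : ℝ) < (n - j : ℕ) := by exact_mod_cast h0
    have h3' : ((B.card - j).choose (k - j) : ℝ) ≤
        (n - j).choose (k - j) * (((B.card - j : ℕ) : ℝ) / (n - j : ℕ)) ^ (k - j) := by
      rw [div_pow, ← mul_div_assoc, le_div_iff₀ (by positivity)]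
      exact_mod_cast h3
    refine h3'.trans ?_
    gcongr ?_ * ?_ ^ _
    rw [div_le_div_iff₀ h0' hn', Nat.cast_sub hjB, Nat.cast_sub (hjk.trans hkn)]
    have : (B.card : ℝ) ≤ n := by exact_mod_cast hBn
    nlinarith [(Nat.cast_nonneg j : (0 : ℝ) ≤ j)]
  rw [div_le_iff₀ hch0]
  have h4' : (n.choose k : ℝ) * k.choose j = n.choose j * (n - j).choose (k - j) := by
    exact_mod_cast h4
  calc _ ≤ (A.card.choose j : ℝ) * (B.card - j).choose (k - j) := by exact_mod_cast h1
    _ ≤ (n.choose j * ((A.card : ℝ) / n) ^ j) *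
        ((n - j).choose (k - j) * ((B.card : ℝ) / n) ^ (k - j)) := by gcongr
    _ = (n.choose j * (n - j).choose (k - j)) * ((A.card : ℝ) / n) ^ j *
        ((B.card : ℝ) / n) ^ (k - j) := by ring
    _ = _ := by rw [← h4']; ring

/-- A random clause contained in `B` with at least `j` variables in `A ⊆ B`. -/
theorem prob_clauseDist_subset_le {n k c : ℕ} (p : unitInterval) (hadm : AdmissibleParams k n c)
    {κ : ℝ} (hκ : 1 ≤ κ) (hch : (n.choose k : ℝ) ≤ κ * (c : ℝ) ^ k * ((n / c).choose k : ℕ))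
    {S : Finpartition (Finset.univ : Finset (Fin n))} (hS : S ∈ communityPartitions n c)
    {j : ℕ} (hjk : j ≤ k) {A B : Finset (Fin n)} (hAB : A ⊆ B) :
    prob (clauseDist k p S) {C | C ∈ kClauses n k ∧ C.vars ⊆ B ∧ j ≤ (C.vars ∩ A).card} ≤
      ENNReal.ofReal (κ * (c : ℝ) ^ (k - 1) *
        (k.choose j * ((A.card : ℝ) / n) ^ j * ((B.card : ℝ) / n) ^ (k - j))) := by
  classical
  have hn : k ≤ n := le_trans (Nat.le_mul_of_pos_left k (by have := hadm.2; omega)) hadm.mul_le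
  refine (prob_clauseDist_le p hadm hκ hch hS
    (F := (Finset.univ.powersetCard k).filter fun V : Finset (Fin n) =>
      V ⊆ B ∧ j ≤ (V ∩ A).card) (fun V hV => by simp at hV; exact hV.1) ?_).trans
    (ENNReal.ofReal_le_ofReal ?_)
  · rintro C hC ⟨-, hCB, hCA⟩
    simp only [kClauses, Finset.mem_filter, Finset.mem_univ, true_and] at hC
    simp [hC.2, hCB, hCA]
  · gcongr
    exact card_sets_le (by have := hadm.2.1; omega) hjk hn hAB

theorem prob_clauseDist_not_mem_kClauses {n k c : ℕ} (p : unitInterval)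
    (hadm : AdmissibleParams k n c) {S : Finpartition (Finset.univ : Finset (Fin n))}
    (hS : S ∈ communityPartitions n c) :
    prob (clauseDist k p S) {C | C ∉ kClauses n k} = 0 := by
  classical
  refine le_antisymm (prob_bind_le fun b _ => ?_) zero_le
  have key : ∀ G : Finset (Clause n), G.Nonempty → G ⊆ kClauses n k →
      prob (uniformOn G) {C | C ∉ kClauses n k} ≤ 0 := by
    intro G hG hsub
    rw [prob_uniformOn hG, Finset.filter_false_of_mem]
    · simp
    · exact fun C hC => not_not.2 (hsub hC)
  cases b
  · exact key _ (bridgeClauses_nonempty hadm hS) (Finset.filter_subset _ _)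
  · exact key _ (withinClauses_nonempty hadm hS) (Finset.filter_subset _ _)

/-! ### Union bounds for the failure of expansion -/

/-- The random clause is spread out: up to the factor `K`, it behaves like a uniformly random
`k`-clause with respect to being contained in `B` with at least `j` variables in `A`. -/
structure SpreadClause (n k : ℕ) (K : ℝ) (q : PMF (Clause n)) : Prop where
  kClause : prob q {C | C ∉ kClauses n k} = 0
  subset_le : ∀ j ≤ k, ∀ A B : Finset (Fin n), A ⊆ B →
    prob q {C | C ∈ kClauses n k ∧ C.vars ⊆ B ∧ j ≤ (C.vars ∩ A).card} ≤
      ENNReal.ofReal (K * (k.choose j * ((A.card : ℝ) / n) ^ j * ((B.card : ℝ) / n) ^ (k - j)))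

/-- Some `r` clauses of `φ` are contained in `A ∪ T` for a set `A` of `s` variables, and have at
least `j` variables in `A` each. -/
def Formula.Crowded {n m : ℕ} (φ : Formula n m) (k : ℕ) (T : Finset (Fin n)) (j s r : ℕ) : Prop :=
  ∃ R : Finset (Fin m), R.card = r ∧ ∃ A ∈ (Finset.univ : Finset (Fin n)).powersetCard s,
    ∀ i ∈ R, φ i ∈ kClauses n k ∧ (φ i).vars ⊆ A ∪ T ∧ j ≤ ((φ i).vars ∩ A).card

/-- The first-moment bound for `Formula.Crowded`. -/
noncomputable def crowdedBound (n m k : ℕ) (K : ℝ) (τ j s r : ℕ) : ℝ :=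
  m.choose r * n.choose s *
    (K * (k.choose j * ((s : ℝ) / n) ^ j * (((s : ℝ) + τ) / n) ^ (k - j))) ^ r

theorem crowdedBound_nonneg {n m k : ℕ} {K : ℝ} (hK : 0 ≤ K) (τ j s r : ℕ) :
    0 ≤ crowdedBound n m k K τ j s r := by
  unfold crowdedBound; positivity

section

variable {n k m : ℕ} {K : ℝ} {q : PMF (Clause n)} {T : Finset (Fin n)} {τ : ℕ}

theorem prob_crowded_le (hq : SpreadClause n k K q) (hK : 0 ≤ K) (hT : T.card ≤ τ) {j : ℕ}
    (hj : j ≤ k) (s r : ℕ) :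
    prob (iid m q) {φ | Formula.Crowded φ k T j s r} ≤
      ENNReal.ofReal (crowdedBound n m k K τ j s r) := by
  classical
  refine (prob_iid_exists_common_le q r ((Finset.univ : Finset (Fin n)).powersetCard s)
    (fun A => {C | C ∈ kClauses n k ∧ C.vars ⊆ A ∪ T ∧ j ≤ (C.vars ∩ A).card})
    (η := ENNReal.ofReal
      (K * (k.choose j * ((s : ℝ) / n) ^ j * (((s : ℝ) + τ) / n) ^ (k - j)))) ?_).trans ?_
  · intro A hA
    rw [Finset.mem_powersetCard] at hA
    refine (hq.subset_le j hj A (A ∪ T) Finset.subset_union_left).trans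
      (ENNReal.ofReal_le_ofReal ?_)
    have : ((A ∪ T).card : ℝ) ≤ s + τ := by
      exact_mod_cast (Finset.card_union_le A T).trans (by omega)
    rw [hA.2]
    gcongr
  · rw [crowdedBound, ENNReal.ofReal_mul (by positivity : (0 : ℝ) ≤ m.choose r * n.choose s),
      ENNReal.ofReal_mul (by positivity : (0 : ℝ) ≤ m.choose r),
      ENNReal.ofReal_natCast, ENNReal.ofReal_natCast, ENNReal.ofReal_pow (by positivity),
      Finset.card_powersetCard, Finset.card_univ, Fintype.card_fin]

theorem prob_exists_not_mem_kClauses (hq : SpreadClause n k K q) :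
    prob (iid m q) {φ | ∃ i, φ i ∉ kClauses n k} = 0 := by
  classical
  refine le_antisymm ?_ zero_le
  calc _ ≤ prob (iid m q) {φ | ∃ i ∈ Finset.univ, φ ∈ {φ : Fin m → Clause n |
        ∀ i' ∈ ({i} : Finset (Fin m)), φ i' ∈ {C | C ∉ kClauses n k}}} :=
        prob_mono _ (by rintro φ ⟨i, hi⟩; exact ⟨i, Finset.mem_univ i, by simpa using hi⟩)
    _ ≤ ∑ i : Fin m, 0 := by
        refine (prob_exists_mem_finset_le _ _ _).trans (Finset.sum_le_sum fun i _ => ?_)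
        rw [prob_iid_forall_mem, hq.kClause]
        simp
    _ = 0 := by simp

/-- A clause with at most one variable outside `T`. -/
theorem prob_exists_mostly_subset_le (hq : SpreadClause n k K q) (hK : 0 ≤ K) (hk : 0 < k)
    (hT : T.card ≤ τ) :
    prob (iid m q) {φ | ∃ i, φ i ∈ kClauses n k ∧ k - 1 ≤ ((φ i).vars ∩ T).card} ≤
      ENNReal.ofReal (m * (K * (k * ((τ : ℝ) / n) ^ (k - 1)))) := by
  classical
  calc _ ≤ prob (iid m q) {φ | ∃ i ∈ Finset.univ, φ ∈ {φ : Fin m → Clause n |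
        ∀ i' ∈ ({i} : Finset (Fin m)), φ i' ∈ {C | C ∈ kClauses n k ∧ C.vars ⊆ Finset.univ ∧
          k - 1 ≤ (C.vars ∩ T).card}}} :=
        prob_mono _ (by rintro φ ⟨i, hi⟩; exact ⟨i, Finset.mem_univ i, by simpa using hi⟩)
    _ ≤ ∑ i : Fin m, ENNReal.ofReal (K * (k * ((τ : ℝ) / n) ^ (k - 1))) := by
        refine (prob_exists_mem_finset_le _ _ _).trans (Finset.sum_le_sum fun i _ => ?_)
        rw [prob_iid_forall_mem, Finset.card_singleton, pow_one]
        refine (hq.subset_le (k - 1) (by omega) T Finset.univ (Finset.subset_univ T)).trans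
          (ENNReal.ofReal_le_ofReal ?_)
        have hch : k.choose (k - 1) = k := by
          rw [Nat.choose_symm (by omega : 1 ≤ k), Nat.choose_one_right]
        rw [hch, Finset.card_univ, Fintype.card_fin]
        have hT' : (T.card : ℝ) ≤ τ := by exact_mod_cast hT
        have h1 : ((n : ℝ) / n) ^ (k - (k - 1)) ≤ 1 := pow_le_one₀ (by positivity) (div_self_le_one _)
        calc _ ≤ K * (k * ((τ : ℝ) / n) ^ (k - 1) * 1) := by gcongr
          _ = _ := by rw [mul_one]
    _ = _ := by
        rw [Finset.sum_const, Finset.card_univ, Fintype.card_fin, nsmul_eq_mul,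
          ENNReal.ofReal_mul (by positivity : (0 : ℝ) ≤ m), ENNReal.ofReal_natCast]

/-- If Hall's condition fails for `r` clauses that have two or more variables outside `T` each, then
these are crowded in a set of `r - 1` variables. -/
theorem Formula.crowded_of_not_hall {φ : Formula n m} (hφ : ∀ i, φ i ∈ kClauses n k)
    (hφT : ∀ i, ((φ i).vars ∩ T).card < k - 1) {R : Finset (Fin m)}
    (hRn : R.card ≤ n) (hR : (φ.varsOutside T R).card < R.card) :
    2 ≤ R.card ∧ φ.Crowded k T 2 (R.card - 1) R.card := by
  classical
  obtain ⟨A, hUA, hA⟩ := Finset.exists_superset_card_eq (s := φ.varsOutside T R)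
    (n := R.card - 1) (by omega) (by simp; omega)
  have hout : ∀ i ∈ R, 2 ≤ ((φ i).vars ∩ A).card ∧ (φ i).vars ⊆ A ∪ T := by
    intro i hi
    have hsub : (φ i).vars \ T ⊆ A := fun v hv => hUA (Finset.mem_biUnion.2 ⟨i, hi, hv⟩)
    have h1 := hφ i
    simp only [kClauses, Finset.mem_filter, Finset.mem_univ, true_and] at h1
    have h2 := Finset.card_sdiff_add_card_inter (φ i).vars T
    have h3 : ((φ i).vars \ T).card ≤ ((φ i).vars ∩ A).card :=
      Finset.card_le_card (Finset.subset_inter Finset.sdiff_subset hsub)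
    have h4 := hφT i
    refine ⟨by omega, fun v hv => ?_⟩
    by_cases hvT : v ∈ T
    · exact Finset.mem_union_right _ hvT
    · exact Finset.mem_union_left _ (hsub (Finset.mem_sdiff.2 ⟨hv, hvT⟩))
  refine ⟨?_, R, rfl, A, by simp [hA], fun i hi => ⟨hφ i, (hout i hi).2, (hout i hi).1⟩⟩
  obtain ⟨i, hi⟩ : R.Nonempty := Finset.card_pos.1 (by omega)
  have h5 : ((φ i).vars ∩ A).card ≤ A.card := Finset.card_le_card Finset.inter_subset_right
  have := (hout i hi).1
  omega

/-- The chance that Hall's condition outside `T` fails for some set of at most `r₀` clauses. -/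
theorem prob_not_hall_le (hq : SpreadClause n k K q) (hK : 0 ≤ K) (hk : 2 ≤ k) (hT : T.card ≤ τ)
    (r₀ : ℝ) (hr₀ : r₀ ≤ n) :
    prob (iid m q) {φ | (∃ i, φ i ∉ kClauses n k) ∨ ∃ R : Finset (Fin m), (R.card : ℝ) ≤ r₀ ∧
        (Formula.varsOutside φ T R).card < R.card} ≤
      ENNReal.ofReal (m * (K * (k * ((τ : ℝ) / n) ^ (k - 1))) +
        ∑ r ∈ (Finset.range (m + 1)).filter (fun r : ℕ => 2 ≤ r ∧ (r : ℝ) ≤ r₀),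
          crowdedBound n m k K τ 2 (r - 1) r) := by
  classical
  set J := (Finset.range (m + 1)).filter (fun r : ℕ => 2 ≤ r ∧ (r : ℝ) ≤ r₀)
  calc _ ≤ prob (iid m q) ({φ | ∃ i, φ i ∉ kClauses n k} ∪
        ({φ | ∃ i, φ i ∈ kClauses n k ∧ k - 1 ≤ ((φ i).vars ∩ T).card} ∪
          {φ | ∃ r ∈ J, φ ∈ {φ | Formula.Crowded φ k T 2 (r - 1) r}})) := by
        refine prob_mono _ ?_
        rintro φ hφ
        by_cases h0 : ∃ i, φ i ∉ kClauses n k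
        · exact Or.inl h0
        by_cases h1 : ∃ i, φ i ∈ kClauses n k ∧ k - 1 ≤ ((φ i).vars ∩ T).card
        · exact Or.inr (Or.inl h1)
        obtain ⟨R, hRr, hR⟩ := hφ.resolve_left h0
        push Not at h0 h1
        obtain ⟨h2, hcr⟩ := Formula.crowded_of_not_hall h0 (fun i => h1 i (h0 i))
          (by exact_mod_cast hRr.trans hr₀) hR
        refine Or.inr (Or.inr ⟨R.card, Finset.mem_filter.2 ⟨?_, h2, hRr⟩, hcr⟩)
        have := R.card_le_univ
        rw [Fintype.card_fin] at this
        exact Finset.mem_range.2 (by omega)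
    _ ≤ 0 + (ENNReal.ofReal (m * (K * (k * ((τ : ℝ) / n) ^ (k - 1)))) +
          ∑ r ∈ J, ENNReal.ofReal (crowdedBound n m k K τ 2 (r - 1) r)) := by
        refine (prob_union_le _ _ _).trans (add_le_add (prob_exists_not_mem_kClauses hq).le
          ((prob_union_le _ _ _).trans (add_le_add
            (prob_exists_mostly_subset_le hq hK (by omega) hT) ?_)))
        exact (prob_exists_mem_finset_le _ _ _).trans
          (Finset.sum_le_sum fun r _ => prob_crowded_le hq hK hT hk _ _)
    _ = _ := by
        rw [zero_add, ENNReal.ofReal_add (by positivity)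
          (Finset.sum_nonneg fun r _ => crowdedBound_nonneg hK _ _ _ _),
          ENNReal.ofReal_sum_of_nonneg fun r _ => crowdedBound_nonneg hK _ _ _ _]

/-- The chance that a formula does not expand relative to a fixed set `T` of `τ` variables. -/
theorem prob_not_expands_le (hq : SpreadClause n k K q) (hK : 0 ≤ K) (hk : 2 ≤ k)
    (hT : T.card ≤ τ) {ε r₀ : ℝ} (hr₀ : r₀ ≤ n) (hr₀' : r₀ * ((k + ε) / 2) ≤ n) (hε : 0 ≤ ε) :
    prob (iid m q) {φ | ¬ Formula.Expands φ k ε r₀ T} ≤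
      ENNReal.ofReal (m * (K * (k * ((τ : ℝ) / n) ^ (k - 1))) +
        ∑ r ∈ (Finset.range (m + 1)).filter (fun r : ℕ => 2 ≤ r ∧ (r : ℝ) ≤ r₀),
          crowdedBound n m k K τ 2 (r - 1) r +
        ∑ r ∈ (Finset.range (m + 1)).filter (fun r : ℕ => r₀ / 2 < r ∧ (r : ℝ) ≤ r₀),
          crowdedBound n m k K τ 0 ⌊(r : ℝ) * ((k + ε) / 2)⌋₊ r) := by
  classical
  set J := (Finset.range (m + 1)).filter (fun r : ℕ => r₀ / 2 < r ∧ (r : ℝ) ≤ r₀)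
  have hbd := fun τ j s r => crowdedBound_nonneg (n := n) (m := m) (k := k) hK τ j s r
  calc _ ≤ prob (iid m q) ({φ | (∃ i, φ i ∉ kClauses n k) ∨ ∃ R : Finset (Fin m),
          (R.card : ℝ) ≤ r₀ ∧ (Formula.varsOutside φ T R).card < R.card} ∪
        {φ | ∃ r ∈ J, φ ∈ {φ | Formula.Crowded φ k T 0 ⌊(r : ℝ) * ((k + ε) / 2)⌋₊ r}}) := by
        refine prob_mono _ ?_
        rintro φ hφ
        by_contra hcon
        simp only [Set.mem_union, Set.mem_ofPred_eq, not_or] at hcon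
        obtain ⟨⟨h0, h1⟩, h2⟩ := hcon
        push Not at h0 h1
        refine hφ ⟨fun i => ?_, fun R hR => h1 R hR, fun R hR hR' => ?_⟩
        · have := h0 i
          simp only [kClauses, Finset.mem_filter, Finset.mem_univ, true_and] at this
          exact this.2.le
        · by_contra hU
          have hfl : (Formula.varsOutside φ T R).card ≤ ⌊(R.card : ℝ) * ((k + ε) / 2)⌋₊ :=
            Nat.le_floor (not_lt.1 hU)
          have hfn : ⌊(R.card : ℝ) * ((k + ε) / 2)⌋₊ ≤ n := by
            refine Nat.floor_le_of_le (le_trans ?_ hr₀')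
            gcongr
          obtain ⟨A, hUA, hA⟩ := Finset.exists_superset_card_eq hfl (by simpa using hfn)
          have hRm := R.card_le_univ
          rw [Fintype.card_fin] at hRm
          refine h2 ⟨R.card, Finset.mem_filter.2 ⟨Finset.mem_range.2 (by omega), hR, hR'⟩,
            R, rfl, A, by simp [hA], fun i hi => ⟨h0 i, fun v hv => ?_, Nat.zero_le _⟩⟩
          by_cases hvT : v ∈ T
          · exact Finset.mem_union_right _ hvT
          · exact Finset.mem_union_left _ (hUA (Finset.mem_biUnion.2
              ⟨i, hi, Finset.mem_sdiff.2 ⟨hv, hvT⟩⟩))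
    _ ≤ _ + ∑ r ∈ J,
          ENNReal.ofReal (crowdedBound n m k K τ 0 ⌊(r : ℝ) * ((k + ε) / 2)⌋₊ r) := by
        refine (prob_union_le _ _ _).trans (add_le_add
          (prob_not_hall_le hq hK hk hT r₀ hr₀) ?_)
        exact (prob_exists_mem_finset_le _ _ _).trans
          (Finset.sum_le_sum fun r _ => prob_crowded_le hq hK hT (Nat.zero_le _) _ _)
    _ = _ := by
        rw [← ENNReal.ofReal_sum_of_nonneg fun r _ => hbd _ _ _ _, ← ENNReal.ofReal_add
          (add_nonneg (by positivity) (Finset.sum_nonneg fun r _ => hbd _ _ _ _))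
          (Finset.sum_nonneg fun r _ => hbd _ _ _ _)]

end

/-! ### Estimates for the union bounds -/

theorem choose_le_exp_mul_pow (n s : ℕ) {u : ℝ} (hu : 0 < u) :
    (n.choose s : ℝ) ≤ Real.exp u * ((n : ℝ) / u) ^ s := by
  have h1 : u ^ s / s.factorial ≤ Real.exp u := Real.pow_div_factorial_le_exp u hu.le s
  calc (n.choose s : ℝ) ≤ n ^ s / s.factorial := Nat.choose_le_pow_div _ _
    _ = u ^ s / s.factorial * ((n : ℝ) / u) ^ s := by
      rw [div_pow]; field_simp
    _ ≤ _ := by gcongr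

theorem sum_pow_le_of_le {J : Finset ℕ} {N₀ : ℕ} (hJ : ∀ r ∈ J, N₀ ≤ r) {b : ℝ} (hb0 : 0 ≤ b)
    (hb1 : b < 1) : ∑ r ∈ J, b ^ r ≤ b ^ N₀ / (1 - b) := by
  classical
  have hs := (hasSum_geometric_of_lt_one hb0 hb1).mul_left (b ^ N₀)
  calc ∑ r ∈ J, b ^ r = ∑ r ∈ J, b ^ N₀ * b ^ (r - N₀) :=
        Finset.sum_congr rfl fun r hr => by rw [← pow_add, Nat.add_sub_cancel' (hJ r hr)]
    _ = ∑ i ∈ J.image (· - N₀), b ^ N₀ * b ^ i := by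
        rw [Finset.sum_image]
        intro a ha c hc h
        have := hJ a ha
        have := hJ c hc
        dsimp only at h
        omega
    _ ≤ b ^ N₀ * (1 - b)⁻¹ := sum_le_hasSum _ (fun i _ => by positivity) hs
    _ = _ := by rw [div_eq_mul_inv]

theorem two_rpow_neg_le (k : ℕ) : (2 : ℝ) ^ (-(7 * (k : ℝ) / 2)) ≤ (1 / 8) ^ k := by
  rw [Real.rpow_neg (by norm_num), one_div, inv_pow]
  gcongr
  calc (8 : ℝ) ^ k = 2 ^ (3 * (k : ℝ)) := by
        rw [Real.rpow_mul (by norm_num), Real.rpow_natCast]; norm_num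
    _ ≤ _ := Real.rpow_le_rpow_of_exponent_le (by norm_num) (by
        have : (0 : ℝ) ≤ k := by positivity
        linarith)

theorem expansion_const_aux (k : ℕ) (hk : 3 ≤ k) :
    ((k : ℝ) + 1) * 2.3317 ^ (k + 1) * 0.132585 ^ k ≤ 0.29 := by
  induction k, hk using Nat.le_induction with
  | base => norm_num
  | succ k hk ih =>
    have hk' : (3 : ℝ) ≤ k := by exact_mod_cast hk
    refine le_trans ?_ ih
    push_cast
    rw [pow_succ _ (k + 1), pow_succ (0.132585 : ℝ) k]
    have hP : (0 : ℝ) < 2.3317 ^ (k + 1) * 0.132585 ^ k := by positivity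
    nlinarith

/-- The constant in the union bound for large sets of clauses. -/
theorem expansion_const_le {k : ℕ} (hk : 3 ≤ k) {a : ℝ} (ha0 : 0 < a) (ha : a ≤ (k + 1) / 2) :
    2 * Real.exp 1 * a * (2 * Real.exp 1) ^ a * (3 / 2) ^ k * (2 : ℝ) ^ (-(7 * (k : ℝ) / 2)) ≤
      4 / 5 := by
  have he := Real.exp_one_lt_d9
  have he0 := Real.exp_one_gt_d9
  have h1 : (2 * Real.exp 1) ^ a ≤ (2.3317 : ℝ) ^ (k + 1) := by
    calc (2 * Real.exp 1) ^ a ≤ (2 * Real.exp 1) ^ (((k : ℝ) + 1) / 2) :=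
          Real.rpow_le_rpow_of_exponent_le (by linarith) ha
      _ ≤ ((2.3317 : ℝ) ^ (2 : ℕ)) ^ (((k : ℝ) + 1) / 2) := by
          gcongr
          norm_num at he ⊢
          linarith
      _ = _ := by
          rw [← Real.rpow_natCast, ← Real.rpow_mul (by norm_num), ← Real.rpow_natCast]
          congr 1
          push_cast
          ring
  have h2 : (2 : ℝ) ^ (-(7 * (k : ℝ) / 2)) ≤ (0.08839 : ℝ) ^ k := by
    rw [show -(7 * (k : ℝ) / 2) = (-(7 / 2)) * k by ring, Real.rpow_mul (by norm_num),
      Real.rpow_natCast]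
    gcongr
    refine le_of_pow_le_pow_left₀ (n := 2) (by norm_num) (by norm_num) ?_
    rw [← Real.rpow_natCast, ← Real.rpow_mul (by norm_num)]
    norm_num
  have h3 := expansion_const_aux k hk
  calc _ ≤ 2 * 2.7182818286 * ((k + 1) / 2) * (2.3317 : ℝ) ^ (k + 1) * (3 / 2) ^ k *
        (0.08839 : ℝ) ^ k := by gcongr
    _ = 2.7182818286 * ((k + 1) * 2.3317 ^ (k + 1) * 0.132585 ^ k) := by
        rw [show (0.132585 : ℝ) = 3 / 2 * 0.08839 by norm_num, mul_pow]; ring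
    _ ≤ 2.7182818286 * 0.29 := by gcongr
    _ ≤ _ := by norm_num

/-- The term of the union bound for Hall's condition. -/
theorem crowdedBound_two_le {n m k s τ : ℕ} {K X g : ℝ} (hK : 0 ≤ K) (hk : 3 ≤ k) (hs : 1 ≤ s)
    (hn : 0 < n) (hX0 : 0 < X) (hX1 : X ≤ 1) (hsX : ((s : ℝ) + τ) / n ≤ X) (hg : g ≤ k - 2)
    (hm : m * K ≤ (2 : ℝ) ^ (-(7 * (k : ℝ) / 2)) * X ^ (-g) * n) :
    crowdedBound n m k K τ 2 s (s + 1) ≤ 1 / n * (1 / 2) ^ (s + 1) := by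
  have hs0 : (0 : ℝ) < s := by exact_mod_cast hs
  have hn0 : (0 : ℝ) < n := by exact_mod_cast hn
  have h1 := choose_le_exp_mul_pow m (s + 1) hs0
  have h2 := choose_le_exp_mul_pow n s hs0
  set Y := ((s : ℝ) + τ) / n with hY
  have hY0 : 0 ≤ Y := by positivity
  have hb : m * K / n * (k.choose 2 * Y ^ (k - 2)) ≤ 1 / 64 := by
    have hc2 : (k.choose 2 : ℝ) ≤ 2 ^ k := by exact_mod_cast Nat.choose_le_two_pow k 2
    have hXg : X ^ (-g) * X ^ (k - 2) ≤ 1 := by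
      rw [← Real.rpow_natCast, ← Real.rpow_add hX0, Nat.cast_sub (by omega)]
      exact Real.rpow_le_one hX0.le hX1 (by push_cast; linarith)
    calc _ ≤ (2 : ℝ) ^ (-(7 * (k : ℝ) / 2)) * X ^ (-g) * (2 ^ k * X ^ (k - 2)) := by
          have : m * K / n ≤ (2 : ℝ) ^ (-(7 * (k : ℝ) / 2)) * X ^ (-g) := by
            rwa [div_le_iff₀ hn0]
          gcongr
      _ = (2 : ℝ) ^ (-(7 * (k : ℝ) / 2)) * 2 ^ k * (X ^ (-g) * X ^ (k - 2)) := by ring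
      _ ≤ (1 / 8) ^ k * 2 ^ k * 1 := by gcongr; exact two_rpow_neg_le k
      _ = (1 / 4) ^ k := by rw [mul_one, ← mul_pow]; norm_num
      _ ≤ (1 / 4) ^ 3 := pow_le_pow_of_le_one (by norm_num) (by norm_num) hk
      _ = _ := by norm_num
  have he : Real.exp s * Real.exp s ≤ (8 : ℝ) ^ (s + 1) := by
    have he := Real.exp_one_lt_d9
    have : Real.exp s = Real.exp 1 ^ s := by rw [← Real.exp_nat_mul, mul_one]
    rw [this, ← mul_pow]
    calc (Real.exp 1 * Real.exp 1) ^ s ≤ 8 ^ s := by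
          gcongr
          norm_num at he
          nlinarith [Real.exp_pos 1]
      _ ≤ 8 ^ (s + 1) := pow_le_pow_right₀ (by norm_num) (Nat.le_succ s)
  have h2s : (s : ℝ) ≤ 4 ^ (s + 1) := by
    have : s < 4 ^ s := Nat.lt_pow_self (by norm_num)
    have h' : (4 : ℕ) ^ s ≤ 4 ^ (s + 1) := Nat.pow_le_pow_right (by norm_num) (Nat.le_succ s)
    exact_mod_cast this.le.trans h'
  unfold crowdedBound
  rw [← hY]
  calc _ ≤ (Real.exp s * ((m : ℝ) / s) ^ (s + 1)) * (Real.exp s * ((n : ℝ) / s) ^ s) *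
        (K * (k.choose 2 * ((s : ℝ) / n) ^ 2 * Y ^ (k - 2))) ^ (s + 1) := by gcongr
    _ = s / n * (Real.exp s * Real.exp s) *
        (m * K / n * (k.choose 2 * Y ^ (k - 2))) ^ (s + 1) := by
        have : ((n : ℝ) / s) ^ s = s / n * ((n : ℝ) / s) ^ (s + 1) := by
          rw [pow_succ]; field_simp
        rw [this]
        have h' : m * K / n * (k.choose 2 * Y ^ (k - 2)) = (m : ℝ) / s * ((n : ℝ) / s) *
            (K * (k.choose 2 * ((s : ℝ) / n) ^ 2 * Y ^ (k - 2))) := by field_simp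
        rw [h', mul_pow ((m : ℝ) / s * (n / s)), mul_pow ((m : ℝ) / s)]
        ring
    _ ≤ 4 ^ (s + 1) / n * 8 ^ (s + 1) * (1 / 64) ^ (s + 1) := by gcongr
    _ = 1 / n * (4 * 8 * (1 / 64)) ^ (s + 1) := by rw [mul_pow, mul_pow]; ring
    _ = _ := by norm_num

/-- The term of the union bound for large sets of clauses. In terms of `w = 2 a r / n`, all powers
of `w` and `x` cancel. -/
theorem crowdedBound_zero_le {n m k r τ : ℕ} {K x a : ℝ} (hK : 0 ≤ K) (hk : 3 ≤ k) (hr : 0 < r)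
    (hn : 0 < n) (hx1 : x ≤ 1) (ha0 : 0 < a) (ha : a ≤ (k + 1) / 2)
    (hw1 : 2 * a * r / n ≤ x) (hw2 : x ≤ 2 * (2 * a * r / n)) (hτ : (τ : ℝ) ≤ x * n / 2)
    (hm : m * K ≤ (2 : ℝ) ^ (-(7 * (k : ℝ) / 2)) * x ^ (-(k - 1 - a)) * n) :
    crowdedBound n m k K τ 0 ⌊r * a⌋₊ r ≤ (4 / 5) ^ r := by
  have hr0 : (0 : ℝ) < r := by exact_mod_cast hr
  have hn0 : (0 : ℝ) < n := by exact_mod_cast hn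
  have hk3 : (3 : ℝ) ≤ k := by exact_mod_cast hk
  set w := 2 * a * r / n with hw
  have hw0 : 0 < w := by positivity
  have hx0 : 0 < x := by linarith
  have hu0 : 0 < r * a := by positivity
  have hnu : (n : ℝ) / (r * a) = 2 / w := by rw [hw]; field_simp
  have h1 := choose_le_exp_mul_pow m r hr0
  have h2 : (n.choose ⌊r * a⌋₊ : ℝ) ≤ ((2 * Real.exp 1) ^ a * w ^ (-a)) ^ r := by
    calc (n.choose ⌊r * a⌋₊ : ℝ) ≤ Real.exp (r * a) * (2 / w) ^ ⌊r * a⌋₊ :=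
          hnu ▸ choose_le_exp_mul_pow n _ hu0
      _ ≤ Real.exp (r * a) * (2 / w) ^ ((r : ℝ) * a) := by
          gcongr
          rw [← Real.rpow_natCast]
          refine Real.rpow_le_rpow_of_exponent_le ?_ (Nat.floor_le hu0.le)
          rw [le_div_iff₀ hw0]; linarith
      _ = _ := by
          have e1 : Real.exp (r * a) = (Real.exp 1 ^ a) ^ r := by
            rw [← Real.rpow_natCast, ← Real.rpow_mul (Real.exp_pos 1).le, Real.exp_one_rpow,
              mul_comm]
          have e2 : (2 / w) ^ ((r : ℝ) * a) = (2 ^ a * w ^ (-a)) ^ r := by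
            rw [← Real.rpow_natCast, mul_comm, Real.rpow_mul (by positivity),
              Real.div_rpow (by norm_num) hw0.le, Real.rpow_neg hw0.le, div_eq_mul_inv]
          rw [e1, e2, ← mul_pow, Real.mul_rpow (by norm_num) (Real.exp_pos 1).le]
          congr 1
          ring
  have h3 : ((⌊r * a⌋₊ : ℝ) + τ) / n ≤ 3 / 2 * w := by
    have := Nat.floor_le hu0.le
    rw [div_le_iff₀ hn0]
    have hwn : w * n = 2 * (r * a) := by rw [hw]; field_simp
    nlinarith
  have h4 : m * K / r ≤ (2 : ℝ) ^ (-(7 * (k : ℝ) / 2)) * x ^ (-(k - 1 - a)) * (2 * a / w) := by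
    have : 2 * a / w = n / r := by rw [hw]; field_simp
    rw [this, div_le_iff₀ hr0]
    refine hm.trans (le_of_eq ?_)
    field_simp
  have h5 : x ^ (-(k - 1 - a)) * w ^ ((k : ℝ) - 1 - a) ≤ 1 := by
    rw [Real.rpow_neg hx0.le, inv_mul_le_iff₀ (Real.rpow_pos_of_pos hx0 _), mul_one]
    exact Real.rpow_le_rpow hw0.le hw1 (by linarith)
  have h6 : w ^ ((k : ℝ) - 1 - a) = w ^ (-a) * w ^ k / w := by
    rw [Real.rpow_sub hw0, Real.rpow_sub hw0, Real.rpow_one, Real.rpow_natCast,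
      Real.rpow_neg hw0.le]
    field_simp
  have her : Real.exp r = Real.exp 1 ^ r := by rw [← Real.exp_nat_mul, mul_one]
  unfold crowdedBound
  rw [Nat.choose_zero_right, Nat.sub_zero, pow_zero, Nat.cast_one, one_mul, one_mul]
  calc _ ≤ (Real.exp r * ((m : ℝ) / r) ^ r) * ((2 * Real.exp 1) ^ a * w ^ (-a)) ^ r *
        (K * (3 / 2 * w) ^ k) ^ r := by gcongr
    _ = (Real.exp 1 * (m * K / r) * ((2 * Real.exp 1) ^ a * w ^ (-a)) * (3 / 2 * w) ^ k) ^ r := by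
        rw [her, ← mul_pow, ← mul_pow, ← mul_pow]
        congr 1
        ring
    _ ≤ (4 / 5) ^ r := by
        gcongr
        calc _ ≤ Real.exp 1 * ((2 : ℝ) ^ (-(7 * (k : ℝ) / 2)) * x ^ (-(k - 1 - a)) * (2 * a / w)) *
              ((2 * Real.exp 1) ^ a * w ^ (-a)) * (3 / 2 * w) ^ k := by gcongr
          _ = (2 * Real.exp 1 * a * (2 * Real.exp 1) ^ a * (3 / 2) ^ k *
              (2 : ℝ) ^ (-(7 * (k : ℝ) / 2))) * (x ^ (-(k - 1 - a)) * w ^ ((k : ℝ) - 1 - a)) := by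
              rw [h6, mul_pow]; ring
          _ ≤ (4 / 5) * 1 := by
              gcongr
              exact expansion_const_le hk ha0 ha
          _ = _ := mul_one _

/-! ### Random restrictions -/

section

variable {n τ d : ℕ}

/-- A restriction is given by one literal per block, when the variables are placed by `e` in `τ`
blocks of size `d`. These are the variables it fixes (a chosen place may be vacant). -/
def restrictionVars (e : Fin n ↪ Fin τ × Fin d) (ω : Fin τ → Fin d × Bool) : Finset (Fin n) :=
  Finset.univ.filter fun v => (ω (e v).1).1 = (e v).2

/-- The values that a restriction assigns (meaningful on `restrictionVars e ω`). -/
def restrictionVal (e : Fin n ↪ Fin τ × Fin d) (ω : Fin τ → Fin d × Bool) (v : Fin n) : Bool :=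
  (ω (e v).1).2

theorem card_restrictionVars_le (e : Fin n ↪ Fin τ × Fin d) (ω : Fin τ → Fin d × Bool) :
    (restrictionVars e ω).card ≤ τ := by
  classical
  calc _ ≤ (Finset.univ : Finset (Fin τ)).card := by
        refine Finset.card_le_card_of_injOn (fun v => (e v).1) (fun _ _ => by simp) ?_
        intro v hv w hw h
        simp only [restrictionVars, Finset.coe_filter, Finset.mem_univ, true_and,
          Set.mem_ofPred_eq] at hv hw
        dsimp only at h
        refine e.injective (Prod.ext h ?_)
        rw [← hv, ← hw, h]
    _ = τ := by simp

/-- A random restriction fails to satisfy `C` with probability at most `exp (-#C / (2 d))`: each of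
the `#C` literals of `C` is the choice in its block with probability `1 / (2 d)`. -/
theorem card_not_killed_le (e : Fin n ↪ Fin τ × Fin d) (hd : 0 < d) (C : Clause n)
    [DecidablePred fun ω => ¬ C.Killed (restrictionVars e ω) (restrictionVal e ω)] :
    ((Finset.univ.filter fun ω : Fin τ → Fin d × Bool =>
      ¬ C.Killed (restrictionVars e ω) (restrictionVal e ω)).card : ℝ) ≤
      Fintype.card (Fin τ → Fin d × Bool) * Real.exp (-(C.card / (2 * d))) := by
  classical
  let K : Fin τ → Finset (Fin d × Bool) := fun j =>
    (C.filter fun l => (e l.1).1 = j).image fun l => ((e l.1).2, l.2)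
  have hKc : ∀ j, (K j).card = (C.filter fun l => (e l.1).1 = j).card := by
    intro j
    refine Finset.card_image_of_injOn ?_
    intro l hl l' hl' h
    simp only [Finset.coe_filter, Set.mem_ofPred_eq] at hl hl'
    obtain ⟨h1, h2⟩ := Prod.mk.inj h
    exact Prod.ext (e.injective (Prod.ext (hl.2.trans hl'.2.symm) h1)) h2
  have hsum : ∑ j, (K j).card = C.card := by
    rw [Finset.card_eq_sum_card_fiberwise (f := fun l : Literal n => (e l.1).1)
      (t := Finset.univ) (fun _ _ => by simp)]
    exact Finset.sum_congr rfl fun j _ => hKc j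
  have hd0 : (0 : ℝ) < d := by exact_mod_cast hd
  have hfac : ∀ j, (((K j)ᶜ).card : ℝ) ≤ 2 * d * Real.exp (-((K j).card / (2 * d))) := by
    intro j
    have hle : (K j).card ≤ Fintype.card (Fin d × Bool) := Finset.card_le_univ _
    rw [Finset.card_compl, Nat.cast_sub hle]
    have h1 := Real.add_one_le_exp (-((K j).card / (2 * d : ℝ)))
    have h2 : (Fintype.card (Fin d × Bool) : ℝ) = 2 * d := by simp [mul_comm]
    rw [h2]
    calc (2 * d : ℝ) - (K j).card = 2 * d * (-((K j).card / (2 * d : ℝ)) + 1) := by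
          field_simp; ring
      _ ≤ _ := by gcongr
  calc _ ≤ ((Fintype.piFinset fun j => (K j)ᶜ).card : ℝ) := by
        refine Nat.cast_le.2 (Finset.card_le_card fun ω hω => ?_)
        simp only [Finset.mem_filter, Finset.mem_univ, true_and] at hω
        rw [Fintype.mem_piFinset]
        intro j
        rw [Finset.mem_compl]
        intro hj
        obtain ⟨l, hl, hlω⟩ := Finset.mem_image.1 hj
        obtain ⟨hlC, rfl⟩ := Finset.mem_filter.1 hl
        refine hω ⟨l, hlC, ?_, ?_⟩
        · simp [restrictionVars, ← hlω]
        · simp [restrictionVal, ← hlω]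
    _ = ∏ j, (((K j)ᶜ).card : ℝ) := by rw [Fintype.card_piFinset]; push_cast; rfl
    _ ≤ ∏ j, 2 * d * Real.exp (-((K j).card / (2 * d))) :=
        Finset.prod_le_prod (fun _ _ => by positivity) fun j _ => hfac j
    _ = _ := by
        rw [Finset.prod_mul_distrib, ← Real.exp_sum, ← hsum]
        congr 1
        · simp [mul_comm]
        · rw [Finset.sum_neg_distrib, ← Finset.sum_div]
          push_cast
          rfl

/-- If `φ` has a short refutation, then `φ` fails to expand relative to at least half of the
restrictions: otherwise one of these would satisfy all wide clauses of the refutation. -/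
theorem Formula.card_le_two_mul_card_not_expands {m k : ℕ} {φ : Formula n m} {ε r₀ S : ℝ}
    (e : Fin n ↪ Fin τ × Fin d) (hd : 0 < d) (hε : 0 < ε) (hr₀ : 2 ≤ r₀)
    (hS : S * Real.exp (-(ε * r₀ / 2 / (2 * d))) ≤ 1 / 2) (hφ : HasRefutationOfSizeLE φ S)
    [DecidablePred fun ω => ¬ φ.Expands k ε r₀ (restrictionVars e ω)] :
    Fintype.card (Fin τ → Fin d × Bool) ≤ 2 * (Finset.univ.filter fun ω : Fin τ → Fin d × Bool =>
      ¬ φ.Expands k ε r₀ (restrictionVars e ω)).card := by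
  classical
  obtain ⟨s, hs, P, hP⟩ := hφ
  set Ω := Fin τ → Fin d × Bool
  set B : Finset Ω := Finset.univ.filter fun ω => ¬ φ.Expands k ε r₀ (restrictionVars e ω)
  have hd0 : (0 : ℝ) < d := by exact_mod_cast hd
  let W : Finset (Fin s) := Finset.univ.filter fun i => ε * r₀ / 2 ≤ ((P i).card : ℝ)
  have hsub : Bᶜ ⊆ W.biUnion fun i => Finset.univ.filter fun ω =>
      ¬ (P i).Killed (restrictionVars e ω) (restrictionVal e ω) := by
    intro ω hω
    simp only [B, Finset.mem_compl, Finset.mem_filter, Finset.mem_univ, true_and,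
      not_not] at hω
    obtain ⟨i, hi, hw⟩ := hω.exists_wide hε hr₀ (restrictionVal e ω) hP
    exact Finset.mem_biUnion.2 ⟨i, by simp [W, hw], by simp [hi]⟩
  have hBc : ((Bᶜ).card : ℝ) ≤ Fintype.card Ω / 2 := by
    calc ((Bᶜ).card : ℝ) ≤ ∑ i ∈ W, ((Finset.univ.filter fun ω =>
          ¬ (P i).Killed (restrictionVars e ω) (restrictionVal e ω)).card : ℝ) := by
          exact_mod_cast (Finset.card_le_card hsub).trans Finset.card_biUnion_le
      _ ≤ ∑ i ∈ W, Fintype.card Ω * Real.exp (-(ε * r₀ / 2 / (2 * d))) := by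
          refine Finset.sum_le_sum fun i hi => (card_not_killed_le e hd (P i)).trans ?_
          gcongr
          exact (Finset.mem_filter.1 hi).2
      _ ≤ s * (Fintype.card Ω * Real.exp (-(ε * r₀ / 2 / (2 * d)))) := by
          rw [Finset.sum_const, nsmul_eq_mul]
          gcongr
          exact W.card_le_univ.trans (by simp)
      _ ≤ S * (Fintype.card Ω * Real.exp (-(ε * r₀ / 2 / (2 * d)))) := by gcongr
      _ = Fintype.card Ω * (S * Real.exp (-(ε * r₀ / 2 / (2 * d)))) := by ring
      _ ≤ Fintype.card Ω * (1 / 2) := by gcongr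
      _ = _ := by ring
  have hadd : (B.card : ℝ) + (Bᶜ).card = Fintype.card Ω := by
    exact_mod_cast Finset.card_add_card_compl B
  have : (Fintype.card Ω : ℝ) ≤ 2 * B.card := by linarith
  exact_mod_cast this

end

/-! ### Bounds for the community attachment model -/

/-- Given the communities, the random clause is spread out with `K = κ c ^ (k - 1)`. -/
theorem spreadClause_clauseDist {n k c : ℕ} (p : unitInterval) (hadm : AdmissibleParams k n c)
    {κ : ℝ} (hκ : 1 ≤ κ) (hch : (n.choose k : ℝ) ≤ κ * (c : ℝ) ^ k * ((n / c).choose k : ℕ))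
    {S : Finpartition (Finset.univ : Finset (Fin n))} (hS : S ∈ communityPartitions n c) :
    SpreadClause n k (κ * (c : ℝ) ^ (k - 1)) (clauseDist k p S) where
  kClause := prob_clauseDist_not_mem_kClauses p hadm hS
  subset_le _ hj _ _ hAB := prob_clauseDist_subset_le p hadm hκ hch hS hj hAB

theorem sum_crowdedBound_two_le {n m k τ : ℕ} {K X g r₀ : ℝ} (hK : 0 ≤ K) (hk : 3 ≤ k)
    (hn : 0 < n) (hX0 : 0 < X) (hX1 : X ≤ 1) (hrX : r₀ + τ ≤ X * n + 1) (hg : g ≤ k - 2)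
    (hm : m * K ≤ (2 : ℝ) ^ (-(7 * (k : ℝ) / 2)) * X ^ (-g) * n) :
    ∑ r ∈ (Finset.range (m + 1)).filter (fun r : ℕ => 2 ≤ r ∧ (r : ℝ) ≤ r₀),
      crowdedBound n m k K τ 2 (r - 1) r ≤ 1 / n := by
  have hn0 : (0 : ℝ) < n := by exact_mod_cast hn
  calc _ ≤ ∑ r ∈ (Finset.range (m + 1)).filter (fun r : ℕ => 2 ≤ r ∧ (r : ℝ) ≤ r₀),
        1 / (n : ℝ) * (1 / 2) ^ r := by
        refine Finset.sum_le_sum fun r hr => ?_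
        obtain ⟨-, hr2, hrr⟩ := Finset.mem_filter.1 hr
        obtain ⟨s, rfl⟩ : ∃ s, r = s + 1 := ⟨r - 1, by omega⟩
        refine crowdedBound_two_le hK hk (by omega) hn hX0 hX1 ?_ hg hm
        rw [div_le_iff₀ hn0]
        push_cast at hrr
        rw [Nat.add_sub_cancel]
        linarith
    _ ≤ 1 / n * ((1 / 2) ^ 2 / (1 - 1 / 2)) := by
        rw [← Finset.mul_sum]
        gcongr
        exact sum_pow_le_of_le (fun r hr => (Finset.mem_filter.1 hr).2.1) (by norm_num)
          (by norm_num)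
    _ ≤ 1 / n * 1 := by gcongr; norm_num
    _ = _ := mul_one _

/-- The term of the union bound for clauses with at most one variable outside the restriction. -/
theorem mostly_subset_bound_le {n m k τ : ℕ} {K x g t z : ℝ} (hx0 : 0 < x)
    (hn : 0 < n) (hτt : (τ : ℝ) ≤ t) (ht : (t / n) ^ (k - 1) ≤ x ^ g / n / z)
    (hm : m * K ≤ (2 : ℝ) ^ (-(7 * (k : ℝ) / 2)) * x ^ (-g) * n) :
    m * (K * (k * ((τ : ℝ) / n) ^ (k - 1))) ≤ 1 / z := by
  have hn0 : (0 : ℝ) < n := by exact_mod_cast hn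
  have hxg : 0 < x ^ g := Real.rpow_pos_of_pos hx0 g
  have ht0 : 0 ≤ t := (Nat.cast_nonneg τ).trans hτt
  calc m * (K * (k * ((τ : ℝ) / n) ^ (k - 1))) = m * K * (k * ((τ : ℝ) / n) ^ (k - 1)) := by ring
    _ ≤ (2 : ℝ) ^ (-(7 * (k : ℝ) / 2)) * x ^ (-g) * n * (k * (t / n) ^ (k - 1)) := by gcongr
    _ ≤ (1 / 8) ^ k * x ^ (-g) * n * (8 ^ k * (x ^ g / n / z)) := by
        gcongr
        · exact two_rpow_neg_le k
        · have : k ≤ 8 ^ k := (Nat.lt_pow_self (by norm_num)).le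
          exact_mod_cast this
    _ = ((1 / 8) ^ k * 8 ^ k) * (x ^ (-g) * x ^ g) * (n / n) / z := by ring
    _ = 1 / z := by
        rw [Real.rpow_neg hx0.le, inv_mul_cancel₀ hxg.ne', div_self hn0.ne', ← mul_pow]
        norm_num

theorem sum_crowdedBound_zero_le {n m k τ : ℕ} {K x ε : ℝ} (hK : 0 ≤ K) (hk : 3 ≤ k)
    (hn : 0 < n) (hx0 : 0 < x) (hx1 : x ≤ 1) (hε0 : 0 < ε) (hε1 : ε < 1)
    (hτ : (τ : ℝ) ≤ x * n / 2)
    (hm : m * K ≤ (2 : ℝ) ^ (-(7 * (k : ℝ) / 2)) * x ^ (-(((k : ℝ) - 2 - ε) / 2)) * n) :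
    ∑ r ∈ (Finset.range (m + 1)).filter
        (fun r : ℕ => x * n / (k + ε) / 2 < r ∧ (r : ℝ) ≤ x * n / (k + ε)),
      crowdedBound n m k K τ 0 ⌊(r : ℝ) * ((k + ε) / 2)⌋₊ r ≤
        5 * (4 / 5) ^ ⌊x * n / (k + ε) / 2⌋₊ := by
  have hn0 : (0 : ℝ) < n := by exact_mod_cast hn
  have hk3 : (3 : ℝ) ≤ k := by exact_mod_cast hk
  set r₀ := x * n / (k + ε) with hr₀
  have hr₀0 : 0 < r₀ := by positivity
  calc _ ≤ ∑ r ∈ (Finset.range (m + 1)).filter (fun r : ℕ => r₀ / 2 < r ∧ (r : ℝ) ≤ r₀),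
        (4 / 5 : ℝ) ^ r := by
        refine Finset.sum_le_sum fun r hr => ?_
        obtain ⟨-, hr1, hr2⟩ := Finset.mem_filter.1 hr
        have hw : 2 * (((k : ℝ) + ε) / 2) * r / n = x * (r / r₀) := by
          rw [hr₀]; field_simp
        have hr0 : (0 : ℝ) < r := by linarith
        refine crowdedBound_zero_le (x := x) hK hk (by exact_mod_cast hr0) hn hx1
          (by linarith) (by linarith) ?_ ?_ hτ ?_
        · rw [hw]
          exact mul_le_of_le_one_right hx0.le (by rwa [div_le_one hr₀0])
        · rw [hw]
          have : 1 ≤ 2 * (r / r₀) := by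
            rw [← mul_div_assoc, one_le_div hr₀0]; linarith
          nlinarith
        · rwa [show (k : ℝ) - 1 - (k + ε) / 2 = ((k : ℝ) - 2 - ε) / 2 by ring]
    _ ≤ (4 / 5) ^ ⌊r₀ / 2⌋₊ / (1 - 4 / 5) := by
        refine sum_pow_le_of_le (fun r hr => ?_) (by norm_num) (by norm_num)
        obtain ⟨-, hr1, -⟩ := Finset.mem_filter.1 hr
        exact Nat.floor_le_of_le hr1.le
    _ = _ := by ring

/-- The hypothesis on the number of clauses, in terms of the factor `K = (1 + ε) c ^ (k - 1)`. -/
theorem clause_density_le {n m k c : ℕ} {ε x : ℝ} (hε0 : 0 < ε) (hc : 0 < c)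
    (hm : (m : ℝ) ≤ 1 / ((2 : ℝ) ^ (7 * (k : ℝ) / 2) * (1 + ε) * (c : ℝ) ^ (k - 1)) *
      x ^ (-((k : ℝ) - 2 - ε) / 2) * n) :
    m * ((1 + ε) * (c : ℝ) ^ (k - 1)) ≤
      (2 : ℝ) ^ (-(7 * (k : ℝ) / 2)) * x ^ (-(((k : ℝ) - 2 - ε) / 2)) * n := by
  have hc0 : (0 : ℝ) < c := by exact_mod_cast hc
  rw [Real.rpow_neg (by norm_num), ← neg_div]
  have hK : 0 < (1 + ε) * (c : ℝ) ^ (k - 1) := by positivity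
  calc _ ≤ (1 / ((2 : ℝ) ^ (7 * (k : ℝ) / 2) * (1 + ε) * (c : ℝ) ^ (k - 1)) *
      x ^ (-((k : ℝ) - 2 - ε) / 2) * n) * ((1 + ε) * (c : ℝ) ^ (k - 1)) := by gcongr
    _ = _ := by field_simp

/-- For `x > 1` there are so few clauses that the formula is likely to be satisfiable. -/
theorem prob_unsat_le {n m k c : ℕ} (p : unitInterval) (hk : 3 ≤ k)
    (hadm : AdmissibleParams k n c) {ε x : ℝ} (hε0 : 0 < ε) (hε1 : ε < 1)
    (hch : (n.choose k : ℝ) ≤ (1 + ε) * (c : ℝ) ^ k * ((n / c).choose k : ℕ)) (hx : 1 ≤ x)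
    (hm : (m : ℝ) ≤ 1 / ((2 : ℝ) ^ (7 * (k : ℝ) / 2) * (1 + ε) * (c : ℝ) ^ (k - 1)) *
      x ^ (-((k : ℝ) - 2 - ε) / 2) * n) :
    prob (communityAttachment k n m c p) {φ | φ.Unsat} ≤ ENNReal.ofReal (1 / n) := by
  have hc : 0 < c := by have := hadm.2.2.1; omega
  have hn : 0 < n := lt_of_lt_of_le (Nat.mul_pos hc (by omega)) hadm.mul_le
  have hk3 : (3 : ℝ) ≤ k := by exact_mod_cast hk
  have hmK := clause_density_le hε0 hc hm
  set K := (1 + ε) * (c : ℝ) ^ (k - 1) with hKdef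
  have hK0 : 0 ≤ K := by positivity
  have hK1 : 1 ≤ K := one_le_mul_of_one_le_of_one_le (by linarith)
    (one_le_pow₀ (by exact_mod_cast hc))
  have hmK' : m * K ≤ (2 : ℝ) ^ (-(7 * (k : ℝ) / 2)) * 1 ^ (-(0 : ℝ)) * n := by
    refine hmK.trans ?_
    rw [neg_zero, Real.rpow_zero]
    gcongr
    exact Real.rpow_le_one_of_one_le_of_nonpos hx (by linarith)
  have hmn : (m : ℝ) ≤ n := by
    calc (m : ℝ) ≤ m * K := le_mul_of_one_le_right (by positivity) hK1
      _ ≤ _ := hmK'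
      _ ≤ 1 * 1 * n := by
        rw [neg_zero, Real.rpow_zero]
        gcongr
        exact Real.rpow_le_one_of_one_le_of_nonpos (by norm_num) (by linarith)
      _ = n := by ring
  refine prob_bind_le fun S hS => ?_
  have hq := spreadClause_clauseDist p hadm (by linarith) hch
    (mem_of_mem_support_uniformOn (communityPartitions_nonempty hadm) hS)
  refine (prob_mono _ ?_).trans ((prob_not_hall_le hq hK0 (by omega)
    (T := ∅) (τ := 0) (by simp) m hmn).trans (ENNReal.ofReal_le_ofReal ?_))
  · intro φ hφ
    by_contra hcon
    simp only [Set.mem_ofPred_eq, not_or] at hcon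
    obtain ⟨-, hcon⟩ := hcon
    push Not at hcon
    obtain ⟨a, -, ha⟩ := φ.exists_satBy_of_hall ∅ (fun _ => true) Finset.univ fun R _ =>
      hcon R (by
        have := R.card_le_univ
        rw [Fintype.card_fin] at this
        exact_mod_cast this)
    exact hφ a fun i => ha i (Finset.mem_univ i)
  · have := sum_crowdedBound_two_le (τ := 0) (r₀ := m) hK0 hk hn one_pos le_rfl
      (by push_cast; linarith) (by linarith : (0 : ℝ) ≤ k - 2) hmK'
    rw [Nat.cast_zero, zero_div, zero_pow (by omega), mul_zero, mul_zero, mul_zero, zero_add]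
    exact this

/-- The bound on `t` implies that a restriction of size `t` fixes a small fraction of the variables,
and, in the form needed for clauses with at most one variable outside the restriction, how small. -/
theorem RestrictionSizeBound.le {k n : ℕ} {ε x z t : ℝ}
    (htb : RestrictionSizeBound k n x (2 / (k + ε)) z t) (hk : 3 ≤ k) (hn : 0 < n) (hε0 : 0 < ε)
    (hε1 : ε < 1) (hx0 : 0 < x) (hx1 : x ≤ 1) (ht0 : 0 ≤ t) (hz : 10 ≤ z) :
    t ≤ x * n / 2 ∧ t ≤ n / 10 ∧
      (t / n) ^ (k - 1) ≤ x ^ (((k : ℝ) - 2 - ε) / 2) / n / z := by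
  have hn0 : (0 : ℝ) < n := by exact_mod_cast hn
  have hn1 : (1 : ℝ) ≤ n := by exact_mod_cast hn
  have hk3 : (3 : ℝ) ≤ k := by exact_mod_cast hk
  have hz0 : 0 < z := by linarith
  set g := ((k : ℝ) - 2 - ε) / 2 with hg
  have hg0 : 0 ≤ g := by rw [hg]; linarith
  obtain ⟨htx, htz⟩ := le_min_iff.1 htb
  have hk1 : ((k - 1 : ℕ) : ℝ) = (k : ℝ) - 1 := by rw [Nat.cast_sub (by omega), Nat.cast_one]
  have hk10 : (0 : ℝ) < (k : ℝ) - 1 := by linarith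
  have hexp : 1 - 1 / (2 / ((k : ℝ) + ε) * ((k : ℝ) - 1)) = g / ((k : ℝ) - 1) := by
    rw [hg]; field_simp; ring
  rw [hexp] at htz
  have htn : t ≤ n / 10 := by
    calc t ≤ 1 * n / 10 := by
          refine htz.trans ?_
          gcongr
          · exact Real.rpow_le_one hx0.le hx1 (by positivity)
          · calc (n : ℝ) ^ (1 - 1 / ((k : ℝ) - 1)) ≤ (n : ℝ) ^ (1 : ℝ) :=
                Real.rpow_le_rpow_of_exponent_le hn1 (by
                  have : 0 < 1 / ((k : ℝ) - 1) := by positivity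
                  linarith)
              _ = n := Real.rpow_one _
      _ = _ := by rw [one_mul]
  have htpow : (t / n) ^ (k - 1) ≤ x ^ g / n / z := by
    have h1 : t / n ≤ x ^ (g / ((k : ℝ) - 1)) * (n : ℝ) ^ (-(1 / ((k : ℝ) - 1))) / z := by
      rw [div_le_iff₀ hn0]
      refine htz.trans (le_of_eq ?_)
      rw [sub_eq_add_neg 1 (1 / ((k : ℝ) - 1)), Real.rpow_add hn0, Real.rpow_one]
      ring
    have h2 : z ≤ z ^ (k - 1) := le_self_pow₀ (by linarith) (by omega)
    calc (t / n) ^ (k - 1) ≤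
          (x ^ (g / ((k : ℝ) - 1)) * (n : ℝ) ^ (-(1 / ((k : ℝ) - 1))) / z) ^ (k - 1) := by
          gcongr
      _ = x ^ g * (n : ℝ)⁻¹ / z ^ (k - 1) := by
          rw [div_pow, mul_pow, ← Real.rpow_natCast, ← Real.rpow_natCast, hk1,
            ← Real.rpow_mul hx0.le, ← Real.rpow_mul hn0.le, div_mul_cancel₀ _ hk10.ne',
            neg_mul, div_mul_cancel₀ _ hk10.ne', Real.rpow_neg_one]
      _ ≤ x ^ g * (n : ℝ)⁻¹ / z := by gcongr
      _ = _ := by rw [← div_eq_mul_inv]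
  exact ⟨htx, htn, htpow⟩

/-- The size of the refutation times the chance that a restriction misses a wide clause, where
`1 / log 2 > 1.44` leaves room for replacing `n / t` by the block size `d`. -/
theorem size_mul_exp_le {n τ d : ℕ} {κ ε x t : ℝ} (hκ : 0 < κ) (hε0 : 0 < ε) (hx0 : 0 < x)
    (hn : 0 < n) (ht10 : 10 ≤ t) (htn : t ≤ n / 10) (hτt : (τ : ℝ) ≤ t) (hτt' : t - 1 < τ)
    (hd0 : 0 < d) (hd2 : (d : ℝ) < n / τ + 1) :
    (2 : ℝ) ^ (ε / (4 * κ) * (x * t)) / 8 *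
      Real.exp (-(ε * (x * n / κ) / 2 / (2 * d))) ≤ 1 / 2 := by
  have hn0 : (0 : ℝ) < n := by exact_mod_cast hn
  have hd0' : (0 : ℝ) < d := by exact_mod_cast hd0
  have hτ0 : (0 : ℝ) < τ := by linarith
  have hlog := Real.log_two_lt_d9
  have hlog0 := Real.log_pos (by norm_num : (1 : ℝ) < 2)
  have hdt : Real.log 2 * t ≤ n / d := by
    rw [le_div_iff₀ hd0']
    calc Real.log 2 * t * d ≤ Real.log 2 * t * (n / τ + 1) := by gcongr
      _ = Real.log 2 * t * (n + τ) / τ := by field_simp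
      _ ≤ n := by
        rw [div_le_iff₀ hτ0]
        calc Real.log 2 * t * (n + τ) ≤ 0.6932 * t * (n + n / 10) := by
              gcongr
              · norm_num at hlog ⊢; linarith
              · linarith
          _ = 0.76252 * t * n := by ring
          _ ≤ n * τ := by nlinarith
  have hθ : ε * (x * n / κ) / 2 / (2 * d) = ε / (4 * κ) * x * (n / d) := by
    field_simp; ring
  rw [hθ, Real.rpow_def_of_pos (by norm_num), div_mul_eq_mul_div, ← Real.exp_add]
  have : Real.log 2 * (ε / (4 * κ) * (x * t)) + -(ε / (4 * κ) * x * (n / d)) ≤ 0 := by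
    have h := mul_le_mul_of_nonneg_left hdt (by positivity : 0 ≤ ε / (4 * κ) * x)
    linarith
  have := Real.exp_le_one_iff.2 this
  linarith

/-- For `x ≤ 1`, a random formula is unlikely to have a short refutation. -/
theorem prob_hasRefutation_le {n m k c : ℕ} (p : unitInterval) (hk : 3 ≤ k)
    (hadm : AdmissibleParams k n c) {ε x t z : ℝ} (hε0 : 0 < ε) (hε1 : ε < 1)
    (hch : (n.choose k : ℝ) ≤ (1 + ε) * (c : ℝ) ^ k * ((n / c).choose k : ℕ)) (hx0 : 0 < x)
    (hx1 : x ≤ 1) (ht10 : 10 ≤ t) (htk : k + 1 ≤ t) (hz : 10 ≤ z)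
    (htb : RestrictionSizeBound k n x (2 / (k + ε)) z t)
    (hm : (m : ℝ) ≤ 1 / ((2 : ℝ) ^ (7 * (k : ℝ) / 2) * (1 + ε) * (c : ℝ) ^ (k - 1)) *
      x ^ (-((k : ℝ) - 2 - ε) / 2) * n) :
    prob (communityAttachment k n m c p)
        {φ | HasRefutationOfSizeLE φ ((2 : ℝ) ^ (ε / (4 * (k + ε)) * (x * t)) / 8)} ≤
      ENNReal.ofReal (2 * (1 / z + 1 / n + 5 * (4 / 5) ^ ⌊t / (k + 1)⌋₊)) := by
  classical
  have hc : 0 < c := by have := hadm.2.2.1; omega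
  have hn : 0 < n := lt_of_lt_of_le (Nat.mul_pos hc (by omega)) hadm.mul_le
  have hn0 : (0 : ℝ) < n := by exact_mod_cast hn
  have hn1 : (1 : ℝ) ≤ n := by exact_mod_cast hn
  have hk3 : (3 : ℝ) ≤ k := by exact_mod_cast hk
  have hz0 : 0 < z := by linarith
  have hmK := clause_density_le hε0 hc hm
  set K := (1 + ε) * (c : ℝ) ^ (k - 1) with hKdef
  have hK0 : 0 ≤ K := by positivity
  set g := ((k : ℝ) - 2 - ε) / 2 with hg
  have hg0 : 0 ≤ g := by rw [hg]; linarith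
  obtain ⟨htx, htn, htpow⟩ := htb.le hk hn hε0 hε1 hx0 hx1 (by linarith) hz
  rw [← hg] at htpow
  set τ := ⌊t⌋₊ with hτ
  have hτt : (τ : ℝ) ≤ t := Nat.floor_le (by linarith)
  have hτt' : t - 1 < τ := Nat.sub_one_lt_floor t
  have hτ0 : (0 : ℝ) < τ := by linarith
  set d := ⌈(n : ℝ) / τ⌉₊ with hd
  have hd1 : (n : ℝ) / τ ≤ d := Nat.le_ceil _
  have hd2 : (d : ℝ) < n / τ + 1 := Nat.ceil_lt_add_one (by positivity)
  have hd0' : (0 : ℝ) < d := lt_of_lt_of_le (by positivity) hd1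
  have hd0 : 0 < d := by exact_mod_cast hd0'
  have hblocks : n ≤ τ * d := by
    rw [div_le_iff₀ hτ0, mul_comm] at hd1
    exact_mod_cast hd1
  let e : Fin n ↪ Fin τ × Fin d :=
    (Fin.castLEEmb hblocks).trans finProdFinEquiv.symm.toEmbedding
  set r₀ := x * n / (k + ε) with hr₀
  have hkε : 0 < (k : ℝ) + ε := by linarith
  have hr₀a : r₀ * ((k + ε) / 2) = x * n / 2 := by rw [hr₀]; field_simp
  have hr₀t : t / (k + 1) ≤ r₀ / 2 := by
    rw [hr₀, div_div, div_le_div_iff₀ (by linarith) (by linarith)]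
    nlinarith
  have hr₀2 : 2 ≤ r₀ := by
    have : 1 ≤ t / (k + 1) := by rwa [one_le_div (by linarith)]
    linarith
  have hr₀x : r₀ ≤ x * n / 2 := by
    rw [← hr₀a]
    exact le_mul_of_one_le_right (by linarith) (by linarith)
  have hxn : x * n ≤ n := mul_le_of_le_one_left hn0.le hx1
  have hxn0 : 0 < x * n := by positivity
  have hS : (2 : ℝ) ^ (ε / (4 * (k + ε)) * (x * t)) / 8 *
      Real.exp (-(ε * r₀ / 2 / (2 * d))) ≤ 1 / 2 :=
    size_mul_exp_le hkε hε0 hx0 hn ht10 htn hτt hτt' hd0 hd2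
  refine prob_bind_le fun P hP => ?_
  have hq := spreadClause_clauseDist p hadm (by linarith) hch
    (mem_of_mem_support_uniformOn (communityPartitions_nonempty hadm) hP)
  have : Nonempty (Fin τ → Fin d × Bool) := ⟨fun _ => (⟨0, hd0⟩, true)⟩
  rw [ENNReal.ofReal_mul (by norm_num), show ENNReal.ofReal 2 = 2 by simp]
  refine (prob_mono _ ?_).trans (prob_half_le _
    (fun ω : Fin τ → Fin d × Bool =>
      {φ : Formula n m | ¬ φ.Expands k ε r₀ (restrictionVars e ω)}) fun ω => ?_)
  · intro φ hφ
    exact Formula.card_le_two_mul_card_not_expands e hd0 hε0 hr₀2 hS hφ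
  refine (prob_not_expands_le hq hK0 (by omega) (card_restrictionVars_le e ω)
    (by linarith) (by linarith) hε0.le).trans (ENNReal.ofReal_le_ofReal ?_)
  refine add_le_add (add_le_add ?_ ?_) ?_
  · exact mostly_subset_bound_le hx0 hn hτt htpow hmK
  · exact sum_crowdedBound_two_le hK0 hk hn hx0 hx1 (by linarith) (by rw [hg]; linarith) hmK
  · refine (sum_crowdedBound_zero_le hK0 hk hn hx0 hx1 hε0 hε1 (hτt.trans htx) hmK).trans ?_
    gcongr 5 * ?_
    exact pow_le_pow_of_le_one (by norm_num) (by norm_num) (Nat.floor_le_floor hr₀t)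

/-! ### Asymptotics -/

/-- For large communities, `k`-sets of variables within them are as frequent as to be expected. -/
theorem choose_le_of_large_communities {n k c : ℕ} {ε : ℝ} (hk : 1 ≤ k) (hε0 : 0 < ε) (hε1 : ε < 1)
    (hcn : c ∣ n) (hd : 2 * (k : ℝ) ^ 2 / ε ≤ (n / c : ℕ)) :
    (n.choose k : ℝ) ≤ (1 + ε) * (c : ℝ) ^ k * ((n / c).choose k : ℕ) := by
  have hnd : (n : ℝ) = c * (n / c : ℕ) := by exact_mod_cast (Nat.mul_div_cancel' hcn).symm
  set d := n / c
  have hk1 : (1 : ℝ) ≤ k := by exact_mod_cast hk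
  have hd' : 2 * (k : ℝ) ^ 2 ≤ ε * d := by
    have := (div_le_iff₀ hε0).1 hd
    linarith
  have hd0 : (0 : ℝ) < d := lt_of_lt_of_le (by positivity) hd
  have hkd : (k : ℝ) ≤ d := by nlinarith
  have hkd' : k ≤ d := by exact_mod_cast hkd
  have h1 : (n.choose k : ℝ) ≤ n ^ k / k.factorial := Nat.choose_le_pow_div _ _
  have h2 : ((d + 1 - k : ℕ) : ℝ) ^ k / k.factorial ≤ d.choose k := by
    rw [div_le_iff₀ (by positivity), mul_comm]
    exact_mod_cast (Nat.pow_sub_le_descFactorial d k).trans_eq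
      (Nat.descFactorial_eq_factorial_mul_choose d k)
  -- Bernoulli's inequality for `(1 - k / d) ^ k`
  have h3 : (d : ℝ) ^ k ≤ (1 + ε) * ((d + 1 - k : ℕ) : ℝ) ^ k := by
    have hb := one_add_mul_le_pow (a := -((k : ℝ) / d)) (by
      have : (k : ℝ) / d ≤ 1 := by rwa [div_le_one hd0]
      linarith) k
    have hkk : (k : ℝ) * (k / d) ≤ ε / 2 := by
      rw [← mul_div_assoc, div_le_iff₀ hd0]
      nlinarith
    calc (d : ℝ) ^ k = 1 * (d : ℝ) ^ k := (one_mul _).symm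
      _ ≤ ((1 + ε) * (1 + -((k : ℝ) / d)) ^ k) * (d : ℝ) ^ k := by
          gcongr
          nlinarith
      _ = (1 + ε) * (d - k) ^ k := by
          rw [mul_assoc, ← mul_pow]
          congr 2
          field_simp
          ring
      _ ≤ _ := by
          rw [Nat.cast_sub (by omega)]
          push_cast
          gcongr
          linarith
  calc (n.choose k : ℝ) ≤ (c * d) ^ k / k.factorial := hnd ▸ h1
    _ = (c : ℝ) ^ k * (d : ℝ) ^ k / k.factorial := by rw [mul_pow]
    _ ≤ (c : ℝ) ^ k * ((1 + ε) * ((d + 1 - k : ℕ) : ℝ) ^ k) / k.factorial := by gcongr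
    _ = (1 + ε) * (c : ℝ) ^ k * (((d + 1 - k : ℕ) : ℝ) ^ k / k.factorial) := by ring
    _ ≤ _ := by gcongr

theorem mainTheorem2 (k : ℕ) (hk : 3 ≤ k) (ε : ℝ) (hε0 : 0 < ε) (hε1 : ε < 1)
    -- the numbers of variables for which the model is considered; limits are along these
    (N : Set ℕ) (L : Filter ℕ) (hL : L = atTop ⊓ 𝓟 N)
    (x t z : ℕ → ℝ) (m c : ℕ → ℕ) (p : ℕ → unitInterval)
    (hadm : ∀ n ∈ N, AdmissibleParams k n (c n))
    (hx : ∀ n ∈ N, 0 < x n)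
    (ht : Tendsto t L atTop)
    (hz : Tendsto z L atTop)
    (hc : (fun n => (c n : ℝ)) =o[L] (fun n => (n : ℝ)))
    (htb : ∀ᶠ n in L, RestrictionSizeBound k n (x n) (2 / (k + ε)) (z n) (t n))
    (hm : ∀ᶠ n in L, (m n : ℝ) ≤
      1 / ((2 : ℝ) ^ (7 * (k : ℝ) / 2) * (1 + ε) * (c n : ℝ) ^ (k - 1)) *
        x n ^ (-((k : ℝ) - 2 - ε) / 2) * n) :
    -- with high probability: if the formula is unsatisfiable, it has no short refutation
    Tendsto (fun n => prob (communityAttachment k n (m n) (c n) (p n))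
        {φ | φ.Unsat →
          ¬ HasRefutationOfSizeLE φ ((2 : ℝ) ^ (ε / (4 * (k + ε)) * (x n * t n)) / 8)})
      L (𝓝 1) ∧
    -- the same for the formula conditioned on being unsatisfiable, when this is not too unlikely
    ((∃ δ : ℝ≥0∞, 0 < δ ∧ ∀ᶠ n in L,
        δ ≤ prob (communityAttachment k n (m n) (c n) (p n)) {φ | φ.Unsat}) →
      Tendsto (fun n => condProb (communityAttachment k n (m n) (c n) (p n))
          {φ | ¬ HasRefutationOfSizeLE φ ((2 : ℝ) ^ (ε / (4 * (k + ε)) * (x n * t n)) / 8)}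
          {φ | φ.Unsat})
        L (𝓝 1)) := by
  have hLN : ∀ᶠ n in L, n ∈ N := hL ▸ eventually_inf_principal.2 (Eventually.of_forall fun _ h => h)
  have hLtop : Tendsto (fun n : ℕ => n) L atTop := hL ▸ tendsto_id.mono_left inf_le_left
  let η : ℕ → ℝ := fun n => 2 * (1 / z n + 1 / n + 5 * (4 / 5) ^ ⌊t n / (k + 1)⌋₊)
  have hη : Tendsto (fun n => ENNReal.ofReal (η n)) L (𝓝 0) := by
    have h1 : Tendsto (fun n => 1 / z n) L (𝓝 0) := by
      simp only [one_div]
      exact hz.inv_tendsto_atTop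
    have h2 : Tendsto (fun n : ℕ => 1 / (n : ℝ)) L (𝓝 0) :=
      tendsto_one_div_atTop_nhds_zero_nat.comp hLtop
    have h3 : Tendsto (fun n => (4 / 5 : ℝ) ^ ⌊t n / (k + 1)⌋₊) L (𝓝 0) :=
      (tendsto_pow_atTop_nhds_zero_of_lt_one (by norm_num) (by norm_num)).comp
        (tendsto_nat_floor_atTop.comp (ht.atTop_div_const (by positivity)))
    have h4 : Tendsto η L (𝓝 (2 * (0 + 0 + 5 * 0))) :=
      ((h1.add h2).add (h3.const_mul 5)).const_mul 2
    rw [← ENNReal.ofReal_zero]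
    exact ENNReal.tendsto_ofReal (by simpa using h4)
  have hd : ∀ᶠ n in L, 2 * (k : ℝ) ^ 2 / ε ≤ (n / c n : ℕ) := by
    have hk0 : (0 : ℝ) < k := by exact_mod_cast (by omega : 0 < k)
    have hD : 0 < 2 * (k : ℝ) ^ 2 / ε := by positivity
    filter_upwards [hc.bound (inv_pos.2 hD), hLN] with n hn hnN
    have hc0 : 0 < c n := by have := (hadm n hnN).2; omega
    rw [Nat.cast_div (hadm n hnN).1 (by positivity), le_div_iff₀ (by positivity)]
    rw [Real.norm_natCast, Real.norm_natCast] at hn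
    exact (le_inv_mul_iff₀ hD).1 hn
  have hbad : ∀ᶠ n in L, prob (communityAttachment k n (m n) (c n) (p n))
      ({φ | φ.Unsat} \ {φ | ¬ HasRefutationOfSizeLE φ
        ((2 : ℝ) ^ (ε / (4 * (k + ε)) * (x n * t n)) / 8)}) ≤ ENNReal.ofReal (η n) := by
    filter_upwards [hLN, hd, htb, hm, ht.eventually_ge_atTop 10, ht.eventually_ge_atTop (k + 1),
      hz.eventually_ge_atTop 10] with n hnN hdn htbn hmn ht10 htk hz10
    have hch := choose_le_of_large_communities (by omega) hε0 hε1 (hadm n hnN).1 hdn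
    -- for `x n ≥ 1` the formula is already unlikely to be unsatisfiable
    rcases le_total (x n) 1 with hx1 | hx1
    · refine le_trans (prob_mono _ ?_) (prob_hasRefutation_le (p n) hk (hadm n hnN) hε0 hε1 hch
        (hx n hnN) hx1 ht10 htk hz10 htbn hmn)
      rintro φ ⟨-, hφ⟩
      exact not_not.1 hφ
    · refine (prob_mono _ Set.sdiff_subset).trans ((prob_unsat_le (p n) hk (hadm n hnN) hε0 hε1 hch
        hx1 hmn).trans (ENNReal.ofReal_le_ofReal ?_))
      have hz0 : 0 < z n := by linarith
      have h1 : 0 ≤ 1 / z n := by positivity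
      have h2 : (0 : ℝ) ≤ 1 / n := by positivity
      have h3 : (0 : ℝ) ≤ 5 * (4 / 5) ^ ⌊t n / (k + 1)⌋₊ := by positivity
      change _ ≤ 2 * (1 / z n + 1 / n + 5 * (4 / 5) ^ ⌊t n / (k + 1)⌋₊)
      linarith
  refine ⟨?_, ?_⟩
  · have hlow : Tendsto (fun n => 1 - ENNReal.ofReal (η n)) L (𝓝 1) := by
      simpa using ENNReal.Tendsto.sub tendsto_const_nhds hη (Or.inl ENNReal.one_ne_top)
    refine tendsto_of_tendsto_of_tendsto_of_le_of_le' hlow tendsto_const_nhds ?_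
      (Eventually.of_forall fun n => prob_le_one _ _)
    filter_upwards [hbad] with n hn
    rw [tsub_le_iff_right, ← prob_add_prob_compl (communityAttachment k n (m n) (c n) (p n))
      {φ | φ.Unsat → ¬ HasRefutationOfSizeLE φ
        ((2 : ℝ) ^ (ε / (4 * (k + ε)) * (x n * t n)) / 8)}]
    gcongr
    refine (prob_mono _ ?_).trans hn
    intro φ hφ
    simp only [Set.mem_compl_iff, Set.mem_ofPred_eq, Classical.not_imp] at hφ
    exact hφ
  · rintro ⟨δ, hδ, hδn⟩
    have hlow : Tendsto (fun n => 1 - ENNReal.ofReal (η n) / δ) L (𝓝 1) := by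
      have h0 : Tendsto (fun n => ENNReal.ofReal (η n) / δ) L (𝓝 0) := by
        simpa using ENNReal.Tendsto.div_const hη (Or.inr hδ.ne')
      simpa using ENNReal.Tendsto.sub tendsto_const_nhds h0 (Or.inl ENNReal.one_ne_top)
    refine tendsto_of_tendsto_of_tendsto_of_le_of_le' hlow tendsto_const_nhds ?_
      (Eventually.of_forall fun n => ?_)
    · filter_upwards [hbad, hδn] with n hn hδn
      have hU0 := (hδ.trans_le hδn).ne'
      have hUt := ((prob_le_one (communityAttachment k n (m n) (c n) (p n))
        {φ | φ.Unsat}).trans_lt ENNReal.one_lt_top).ne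
      rw [tsub_le_iff_right, condProb, ← ENNReal.div_self hU0 hUt]
      nth_rewrite 1 [← prob_inter_add_prob_diff _ {φ : Formula n (m n) | φ.Unsat}
        {φ | ¬ HasRefutationOfSizeLE φ ((2 : ℝ) ^ (ε / (4 * (k + ε)) * (x n * t n)) / 8)}]
      rw [ENNReal.add_div, Set.inter_comm]
      gcongr
    · exact ENNReal.div_le_of_le_mul (by rw [one_mul]; exact prob_mono _ Set.inter_subset_right)
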